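/- Let $\Sigma$ be a linearly ordered alphabet. For a non-empty word $S$ let $S^\omega$ be its infinite repetition. For words $S,T$ write $S =_{\mathrm{alt}} T$ if $S^\omega=T^\omega$. For non-empty $S,T$ with $S^\omega\ne T^\omega$, let $j\ge 1$ be the first position with $S^\omega[j]\ne T^\omega[j]$, and write $S\prec_{\mathrm{alt}}T$ if either $j$ is odd and $S^\omega[j]<T^\omega[j]$, or $j$ is even and $S^\omega[j]>T^\omega[j]$; moreover $X\prec_{\mathrm{alt}}\varepsilon$ for every non-empty $X$. Write $S\preceq_{\mathrm{alt}}T$ if $S\prec_{\mathrm{alt}}T$ or $S=_{\mathrm{alt}}T$. A non-empty word is Galois if it is strictly smaller in $\prec_{\mathrm{alt}}$ than all its other cyclic rotations. A word $T$ is pre-Galois if every proper suffix $S$ of $T$ is a prefix of $T$ or satisfies $S\succ_{\mathrm{alt}}T$. A Galois factorization of $T$ is a factorization $T=G_1G_2\cdots G_k$ ($k \ge 0$) into Galois words with $G_1\succeq_{\mathrm{alt}}G_2\succeq_{\mathrm{alt}}\cdots\succeq_{\mathrm{alt}}G_k$. Theorem. Every word $T\in\Sigma^*$ has exactly one Galois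 factorization, and it can be computed online in $O(|T|)$ time with $O(1)$ additional working space, not counting the input and the output. Precisely, there is one comparison-based random access program, independent of $\Sigma$ and $T$, with a constant number of registers, for which the following holds. The program accesses the letters of the read-only text only by comparing ($<$, $=$, $>$) two letters at given positions among those already revealed, and by requesting the next letter, which reveals that letter or reports the end of the text; $|T|$ is not known in advance. Its other instructions are loading a constant, copying, addition, truncated subtraction and conditional jumps on registers, halting, and appending a factor $T[a..b]$ of the revealed text to an append-only output. Every instruction costs one time unit, plus the length of the factor for an output instruction. On every word $T$ over every linearly ordered alphabet, the program halts within $O(|T|+1)$ time and has then output exactly the list $(G_1,\dots,G_k)$ of the Galois factorization of $T$; at all times every register holds a natural number in $O(|T|+1)$ (so the working space is a constant number of machine words); and, whenever the program requests the next letter, the text revealed so far is the concatenation of the factors output so far and of a remainder that is pre-Galois. All constants are absolute. -/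

import Mathlib

/-! ### Words, the alternating order, Galois words -/

namespace GaloisWord

variable {α : Type*}

/-- The letter at (0-based) position `i` of the infinite repetition `S^ω` of a word `S`;
it is `none` for every `i` exactly when `S` is empty. -/
def omegaLetter (S : List α) (i : ℕ) : Option α := S[i % S.length]?

/-- The alternating order `S ≺ T` on words: at the first mismatch of `S^ω` and `T^ω` the letter of
`S^ω` is smaller if the 1-based position of the mismatch is odd (0-based: even), and larger
otherwise. The empty word is larger than every non-empty word. -/
def AltLT [LinearOrder α] (S T : List α) : Prop :=
  (S ≠ [] ∧ T = []) ∨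
    ∃ j : ℕ, (∀ i < j, omegaLetter S i = omegaLetter T i) ∧
      ∃ a b : α, omegaLetter S j = some a ∧ omegaLetter T j = some b ∧
        if Even j then a < b else b < a

/-- `S^ω = T^ω`. -/
def AltEq (S T : List α) : Prop := ∀ i : ℕ, omegaLetter S i = omegaLetter T i

/-- `S ≼ T` in the alternating order. -/
def AltLE [LinearOrder α] (S T : List α) : Prop := AltLT S T ∨ AltEq S T

/-- A Galois word: non-empty and strictly smaller, in the alternating order, than each of its
other cyclic rotations. -/
def IsGalois [LinearOrder α] (T : List α) : Prop :=
  T ≠ [] ∧ ∀ i : ℕ, 0 < i → i < T.length → AltLT T (T.rotate i)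

/-- A pre-Galois word: every proper suffix is a prefix of the word or is larger than the word. -/
def IsPreGalois [LinearOrder α] (T : List α) : Prop :=
  ∀ S : List α, S <:+ T → S ≠ T → S <+: T ∨ AltLT T S

/-- `G = [G₁, …, Gₖ]` is a Galois factorization of `T`: `T = G₁ ⋯ Gₖ`, every `Gᵢ` is Galois, and
`G₁ ≽ G₂ ≽ ⋯ ≽ Gₖ` in the alternating order. -/
def IsGaloisFactorization [LinearOrder α] (T : List α) (G : List (List α)) : Prop :=
  G.flatten = T ∧ (∀ W ∈ G, IsGalois W) ∧ G.IsChain (fun A B => AltLE B A)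

end GaloisWord

/-! ### Comparison-based online random access machines

A machine has a fixed number `k` of registers, each holding a natural number (the main theorem
bounds these numbers by a constant multiple of the input length, i.e. each register is one machine
word), and a fixed program. The input text is read-only; its letters come from an arbitrary linearly
ordered alphabet and can only be compared with each other. The text is revealed letter by letter, on
request; letters that were revealed before can be accessed by their position. The output is an
append-only list of factors of the text. -/

namespace OnlineRAM

/-- Instructions; registers are indexed by `Fin k`, program addresses are natural numbers.
Unless stated otherwise the next instruction is the one at the next address. -/
inductive Instr (k : ℕ) : Type
  /-- Store the constant `v` in register `r`. -/
  | const (r : Fin k) (v : ℕ)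
  /-- Copy register `a` to register `r`. -/
  | copy (r a : Fin k)
  /-- Store the sum of registers `a` and `b` in register `r`. -/
  | add (r a b : Fin k)
  /-- Store the truncated difference of registers `a` and `b` in register `r`. -/
  | sub (r a b : Fin k)
  /-- Jump to address `l` if the content of `a` is at most the content of `b`. -/
  | jle (a b : Fin k) (l : ℕ)
  /-- Compare the revealed letters at the (0-based) positions stored in `a` and `b`; jump to `lt` if
  the first is smaller, to `gt` if it is larger. -/
  | cmp (a b : Fin k) (lt gt : ℕ)
  /-- Request the next letter of the text; jump to address `eof` if there is none. -/
  | read (eof : ℕ)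
  /-- Append to the output the factor of the text that occupies the (0-based) positions `i` with
  `a ≤ i < b`, for the contents `a`, `b` of the two registers. -/
  | emit (a b : Fin k)
  /-- Stop. -/
  | halt

/-- A program is a finite list of instructions; it does not mention the alphabet or the text. -/
abbrev Program (k : ℕ) : Type := List (Instr k)

/-- Configurations: the program counter, the registers, the revealed part of the text, the part
of the text that is not revealed yet, and the output. -/
structure Config (α : Type*) (k : ℕ) where
  pc : ℕ
  reg : Fin k → ℕ
  seen : List α
  rest : List α
  out : List (List α)

/-- The initial configuration on the text `T`: nothing is revealed yet. -/
def init {α : Type*} (k : ℕ) (T : List α) : Config α k where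
  pc := 0
  reg := fun _ => 0
  seen := []
  rest := T
  out := []

/-- One step of the machine, together with its cost in time units. Every instruction costs one
unit, and `emit` costs one more unit for each letter of the factor that it outputs. There is
no step after `halt`, after the program has been left, and on access to an unrevealed position. -/
def step {α : Type*} [LinearOrder α] {k : ℕ} (P : Program k) (c : Config α k) :
    Option (Config α k × ℕ) :=
  match P[c.pc]? with
  | none => none
  | some .halt => none
  | some (.const r v) =>
      some ({ c with pc := c.pc + 1, reg := Function.update c.reg r v }, 1)
  | some (.copy r a) =>
      some ({ c with pc := c.pc + 1, reg := Function.update c.reg r (c.reg a) }, 1)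
  | some (.add r a b) =>
      some ({ c with pc := c.pc + 1, reg := Function.update c.reg r (c.reg a + c.reg b) }, 1)
  | some (.sub r a b) =>
      some ({ c with pc := c.pc + 1, reg := Function.update c.reg r (c.reg a - c.reg b) }, 1)
  | some (.jle a b l) =>
      some ({ c with pc := if c.reg a ≤ c.reg b then l else c.pc + 1 }, 1)
  | some (.cmp a b lt gt) =>
      match c.seen[c.reg a]?, c.seen[c.reg b]? with
      | some x, some y =>
          some ({ c with pc := if x < y then lt else if y < x then gt else c.pc + 1 }, 1)
      | _, _ => none
  | some (.read eof) =>
      match c.rest with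
      | [] => some ({ c with pc := eof }, 1)
      | x :: xs => some ({ c with pc := c.pc + 1, seen := c.seen ++ [x], rest := xs }, 1)
  | some (.emit a b) =>
      if c.reg a ≤ c.reg b ∧ c.reg b ≤ c.seen.length then
        some ({ c with
          pc := c.pc + 1
          out := c.out ++ [(c.seen.drop (c.reg a)).take (c.reg b - c.reg a)] },
          1 + (c.reg b - c.reg a))
      else none

/-- `Reaches P c t d`: the program `P` gets from configuration `c` to configuration `d` in finitely
many steps of total cost `t`. -/
inductive Reaches {α : Type*} [LinearOrder α] {k : ℕ} (P : Program k) (c : Config α k) :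
    ℕ → Config α k → Prop
  | refl : Reaches P c 0 c
  | tail {t w : ℕ} {d e : Config α k} :
      Reaches P c t d → step P d = some (e, w) → Reaches P c (t + w) e

/-- The program has stopped at a `halt` instruction. -/
def Halted {α : Type*} {k : ℕ} (P : Program k) (c : Config α k) : Prop :=
  P[c.pc]? = some .halt

/-- The program is about to request the next letter of the text. -/
def Requests {α : Type*} {k : ℕ} (P : Program k) (c : Config α k) : Prop :=
  ∃ eof : ℕ, P[c.pc]? = some (.read eof)

end OnlineRAM

/-! Uniqueness. For non-empty words, u ≺ v holds exactly when uv ≺ vu. Hence a Galois word is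
strictly smaller than its proper non-empty suffixes (`IsGalois.seqLT_suffix`), while no non-empty
suffix of T is smaller than the last factor of a Galois factorization
(`IsGaloisFactorization.not_seqLT_getLast`). Of two last factors of T one is a suffix of the other,
so they coincide, and induction removes them.

Existence comes from the program, a scan in the manner of Duval. The remainder, of length n, is kept
pre-Galois. If it has period p, the next letter is judged against the letter at n - p in the order
of position n - p, whose sense depends only on the parity of p. Among periods of one parity the
least one predicts the largest letter (`PG.compare_periods`), so the least even and the least odd
period suffice: two comparisons per letter.

When the next letter is too small for the least period p of its parity, copies of a root are split
off. With q the least period of the other parity, the root has length p, except that it has length q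
when p = 2q, because then the prefix of length p is a square. The root is Galois
(`isGalois_of_factorLength`). The number D of letters split off has the parity of p, so that the
failure keeps its sense after the shift; this forces every later factor to be smaller than the root
(`nextLT_of_mismatch`), which gives the descending chain. The end of the text acts as a least
letter.

The scan restarts after those D letters, and n < 3D. Hence a potential of the form 4(|T| - s) - n,
with s the start of the remainder, pays for reading, splitting and rescanning. -/

namespace GaloisWord

/-! ### The alternating order on letters, sequences and infinite repetitions. -/

variable {α : Type*}

/-- The strict order used at (0-based) position `b` by the alternating order. -/
def altRel {β : Type*} [LinearOrder β] (b : ℕ) (x y : β) : Prop := if Even b then x < y else y < x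

section altRel

variable {β : Type*} [LinearOrder β] {b c : ℕ} {x y z : β}

theorem altRel_irrefl : ¬ altRel b x x := by
  unfold altRel; split_ifs <;> exact lt_irrefl _

theorem altRel.trans (h : altRel b x y) (h' : altRel b y z) : altRel b x z := by
  unfold altRel at *; split_ifs at * <;> order

theorem altRel.asymm (h : altRel b x y) : ¬ altRel b y x := fun h' => altRel_irrefl (h.trans h')

theorem altRel_total (h : x ≠ y) : altRel b x y ∨ altRel b y x := by
  unfold altRel; split_ifs
  · exact lt_or_gt_of_ne h
  · exact (lt_or_gt_of_ne h).symm

theorem altRel_of_not (h : ¬ altRel b x y) (hne : x ≠ y) : altRel b y x :=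
  (altRel_total hne).resolve_left h

theorem altRel.trans_not (h : altRel b x y) (h' : ¬ altRel b z y) : altRel b x z := by
  by_cases e : z = y
  · exact e ▸ h
  · exact h.trans (altRel_of_not h' e)

theorem altRel_congr (h : b % 2 = c % 2) : altRel b x y ↔ altRel c x y := by
  simp only [altRel, Nat.even_iff, h]

theorem altRel_flip (h : b % 2 ≠ c % 2) : altRel b x y ↔ altRel c y x := by
  unfold altRel
  by_cases hb : Even b <;> by_cases hc : Even c <;> simp only [Nat.even_iff] at hb hc <;>
    simp only [Nat.even_iff, hb, hc] <;> first | omega | simp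

end altRel

/-- The alternating order on sequences: the first mismatch is in favour of `f`. -/
def SeqLT {β : Type*} [LinearOrder β] (f g : ℕ → β) : Prop :=
  ∃ j, (∀ i < j, f i = g i) ∧ altRel j (f j) (g j)

section SeqLT

variable {β : Type*} [LinearOrder β] {f g h : ℕ → β}

theorem SeqLT.trans (h₁ : SeqLT f g) (h₂ : SeqLT g h) : SeqLT f h := by
  obtain ⟨j, hj, hj'⟩ := h₁
  obtain ⟨k, hk, hk'⟩ := h₂
  rcases lt_trichotomy j k with hlt | rfl | hlt
  · exact ⟨j, fun i hi => (hj i hi).trans (hk i (hi.trans hlt)), hk j hlt ▸ hj'⟩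
  · exact ⟨j, fun i hi => (hj i hi).trans (hk i hi), hj'.trans hk'⟩
  · exact ⟨k, fun i hi => (hj i (hi.trans hlt)).trans (hk i hi), (hj k hlt).symm ▸ hk'⟩

theorem SeqLT.irrefl : ¬ SeqLT f f := fun ⟨_, _, h⟩ => altRel_irrefl h

theorem SeqLT.asymm (h₁ : SeqLT f g) : ¬ SeqLT g f := fun h₂ => SeqLT.irrefl (h₁.trans h₂)

theorem SeqLT.total (hne : f ≠ g) : SeqLT f g ∨ SeqLT g f := by
  classical
  have hex : ∃ j, f j ≠ g j := by
    by_contra! hc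
    exact hne (funext hc)
  have hmin : ∀ i < Nat.find hex, f i = g i := fun i hi => not_not.1 (Nat.find_min hex hi)
  rcases altRel_total (b := Nat.find hex) (Nat.find_spec hex) with h | h
  · exact .inl ⟨_, hmin, h⟩
  · exact .inr ⟨_, fun i hi => (hmin i hi).symm, h⟩

theorem not_seqLT_trans (h₁ : ¬ SeqLT f g) (h₂ : ¬ SeqLT g h) : ¬ SeqLT f h := by
  intro h'
  by_cases e : f = g
  · exact h₂ (e ▸ h')
  · exact h₂ (((SeqLT.total e).resolve_left h₁).trans h')

end SeqLT

/-- The infinite repetition as a sequence over the alphabet with an additional least letter. -/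
def omegaSeq (S : List α) : ℕ → WithBot α := fun i => omegaLetter S i

theorem omegaSeq_ne_bot {S : List α} (hS : S ≠ []) (i : ℕ) :
    ∃ a : α, omegaSeq S i = (a : WithBot α) ∧ omegaLetter S i = some a := by
  have hlt : i % S.length < S.length := Nat.mod_lt _ (List.length_pos_iff.2 hS)
  have : omegaLetter S i = some S[i % S.length] := List.getElem?_eq_getElem hlt
  exact ⟨_, this, this⟩

theorem altEq_iff {S T : List α} : AltEq S T ↔ omegaSeq S = omegaSeq T :=
  ⟨fun h => funext h, fun h i => congrFun h i⟩

theorem altLT_iff [LinearOrder α] {S T : List α} (hS : S ≠ []) (hT : T ≠ []) :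
    AltLT S T ↔ SeqLT (omegaSeq S) (omegaSeq T) := by
  constructor
  · rintro (⟨_, h⟩ | ⟨j, hj, a, b, ha, hb, hab⟩)
    · exact absurd h hT
    · refine ⟨j, hj, ?_⟩
      have ha' : omegaSeq S j = (a : WithBot α) := ha
      have hb' : omegaSeq T j = (b : WithBot α) := hb
      rw [ha', hb']
      simpa only [altRel, WithBot.coe_lt_coe] using hab
  · rintro ⟨j, hj, hab⟩
    obtain ⟨a, ha, ha'⟩ := omegaSeq_ne_bot hS j
    obtain ⟨b, hb, hb'⟩ := omegaSeq_ne_bot hT j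
    rw [ha, hb] at hab
    exact .inr ⟨j, hj, a, b, ha', hb', by simpa only [altRel, WithBot.coe_lt_coe] using hab⟩

theorem altLE_iff [LinearOrder α] {S T : List α} (hS : S ≠ []) (hT : T ≠ []) :
    AltLE S T ↔ ¬ SeqLT (omegaSeq T) (omegaSeq S) := by
  rw [AltLE, altLT_iff hS hT, altEq_iff]
  constructor
  · rintro (h | h)
    · exact h.asymm
    · rw [h]; exact SeqLT.irrefl
  · intro h
    by_cases e : omegaSeq S = omegaSeq T
    · exact .inr e
    · exact .inl ((SeqLT.total e).resolve_right h)

theorem omegaSeq_add_length (S : List α) (i : ℕ) :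
    omegaSeq S (i + S.length) = omegaSeq S i := by
  simp only [omegaSeq, omegaLetter, Nat.add_mod_right]; rfl

theorem omegaSeq_mod (S : List α) (i : ℕ) : omegaSeq S (i % S.length) = omegaSeq S i := by
  simp only [omegaSeq, omegaLetter, Nat.mod_mod]; rfl

theorem omegaSeq_append_left (S X : List α) {i : ℕ} (hi : i < S.length) :
    omegaSeq (S ++ X) i = omegaSeq S i := by
  have h1 : i < (S ++ X).length := by simp; omega
  simp only [omegaSeq, omegaLetter, Nat.mod_eq_of_lt hi, Nat.mod_eq_of_lt h1]
  exact List.getElem?_append_left hi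

theorem omegaSeq_append_right (S X : List α) {i : ℕ} (hi : i < X.length) :
    omegaSeq (S ++ X) (i + S.length) = omegaSeq X i := by
  have h1 : i + S.length < (S ++ X).length := by simp; omega
  simp only [omegaSeq, omegaLetter, Nat.mod_eq_of_lt hi, Nat.mod_eq_of_lt h1]
  rw [List.getElem?_append_right (by omega), Nat.add_sub_cancel]

/-- While uv and vu agree, uv repeats with period |u|: a letter of uv behind u is a letter of v,
hence of vu, hence of uv |u| places earlier. The conclusion includes the position m of a possible
mismatch. -/
theorem omegaSeq_eq_append_of_agree {u v : List α} (m : ℕ)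
    (h : ∀ i < m, omegaSeq (u ++ v) i = omegaSeq (v ++ u) i) (hu : u ≠ [])
    (hm : m < u.length + v.length) : omegaSeq u m = omegaSeq (u ++ v) m := by
  induction m using Nat.strong_induction_on with
  | _ m ih =>
    have hu' := List.length_pos_iff.2 hu
    rcases lt_or_ge m u.length with hlt | hge
    · exact (omegaSeq_append_left u v hlt).symm
    · obtain ⟨i, rfl⟩ : ∃ i, m = i + u.length := ⟨m - u.length, by omega⟩
      rw [omegaSeq_add_length, omegaSeq_append_right u v (by omega),
        ← omegaSeq_append_left v u (by omega), ← h i (by omega)]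
      exact ih i (by omega) (fun j hj => h j (by omega)) (by omega)

theorem omegaSeq_eq_of_append_comm {u v : List α} (hu : u ≠ []) (hv : v ≠ [])
    (h : omegaSeq (u ++ v) = omegaSeq (v ++ u)) : omegaSeq u = omegaSeq v := by
  have hu' := List.length_pos_iff.2 hu
  have hv' := List.length_pos_iff.2 hv
  funext i
  induction i using Nat.strong_induction_on with
  | _ i ih =>
    rcases lt_or_ge i (u.length + v.length) with hlt | hge
    · rw [omegaSeq_eq_append_of_agree i (fun j _ => congrFun h j) hu hlt,
        omegaSeq_eq_append_of_agree i (fun j _ => (congrFun h j).symm) hv (by omega), h]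
    · obtain ⟨j, rfl⟩ : ∃ j, i = j + v.length + u.length := ⟨i - u.length - v.length, by omega⟩
      rw [omegaSeq_add_length, ih _ (by omega), omegaSeq_add_length, ← ih _ (by omega),
        add_right_comm, omegaSeq_add_length, ← ih _ (by omega), omegaSeq_add_length]

/-- Both repetitions have period |u| + |v|, so the first mismatch comes before that length. Up to
and including it, uv looks like the repetition of u and vu like that of v. -/
theorem seqLT_of_append_comm [LinearOrder α] {u v : List α} (hu : u ≠ []) (hv : v ≠ [])
    (h : SeqLT (omegaSeq (u ++ v)) (omegaSeq (v ++ u))) : SeqLT (omegaSeq u) (omegaSeq v) := by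
  have hu' := List.length_pos_iff.2 hu
  obtain ⟨j, hj, hj'⟩ := h
  have hlt : j < u.length + v.length := by
    by_contra! hge
    have hmod : j % (u.length + v.length) < u.length + v.length := Nat.mod_lt _ (by omega)
    have h1 := hj _ (lt_of_lt_of_le hmod hge)
    have h2 := omegaSeq_mod (u ++ v) j
    have h3 := omegaSeq_mod (v ++ u) j
    rw [List.length_append] at h2 h3
    rw [add_comm v.length] at h3
    rw [← h2, ← h3, h1] at hj'
    exact altRel_irrefl hj'
  have e1 : ∀ i ≤ j, omegaSeq u i = omegaSeq (u ++ v) i := fun i hi =>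
    omegaSeq_eq_append_of_agree i (fun k hk => hj k (by omega)) hu (by omega)
  have e2 : ∀ i ≤ j, omegaSeq v i = omegaSeq (v ++ u) i := fun i hi =>
    omegaSeq_eq_append_of_agree i (fun k hk => (hj k (by omega)).symm) hv (by omega)
  refine ⟨j, fun i hi => ?_, ?_⟩
  · rw [e1 i hi.le, e2 i hi.le, hj i hi]
  · rwa [e1 j le_rfl, e2 j le_rfl]

theorem seqLT_append_comm_iff [LinearOrder α] {u v : List α} (hu : u ≠ []) (hv : v ≠ []) :
    SeqLT (omegaSeq (u ++ v)) (omegaSeq (v ++ u)) ↔ SeqLT (omegaSeq u) (omegaSeq v) := by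
  refine ⟨seqLT_of_append_comm hu hv, fun h => ?_⟩
  by_cases e : omegaSeq (u ++ v) = omegaSeq (v ++ u)
  · rw [omegaSeq_eq_of_append_comm hu hv e] at h
    exact absurd h SeqLT.irrefl
  · exact (SeqLT.total e).resolve_right fun h' => h.asymm (seqLT_of_append_comm hv hu h')

theorem SeqLT.append [LinearOrder α] {S T : List α} (hS : S ≠ []) (hlen : S.length = T.length)
    (h : SeqLT (omegaSeq S) (omegaSeq T)) (X Y : List α) :
    SeqLT (omegaSeq (S ++ X)) (omegaSeq (T ++ Y)) := by
  have hS' := List.length_pos_iff.2 hS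
  obtain ⟨j, hj, hj'⟩ := h
  have hlt : j < S.length := by
    by_contra! hge
    have hmod : j % S.length < S.length := Nat.mod_lt _ hS'
    have h1 := hj _ (lt_of_lt_of_le hmod hge)
    have h3 := omegaSeq_mod T j
    rw [← hlen] at h3
    rw [← omegaSeq_mod S j, ← h3, h1] at hj'
    exact altRel_irrefl hj'
  refine ⟨j, fun i hi => ?_, ?_⟩
  · rw [omegaSeq_append_left _ _ (by omega), omegaSeq_append_left _ _ (by omega), hj i hi]
  · rwa [omegaSeq_append_left _ _ hlt, omegaSeq_append_left _ _ (by omega)]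

/-! ### The last factor is minimal among suffixes; uniqueness. -/

/-- From xy ≺ yx, words of equal length, follows (xy)y ≺ y(xy); commuting concatenations then
compares xy with y. -/
theorem IsGalois.seqLT_suffix [LinearOrder α] {x y : List α} (h : IsGalois (x ++ y))
    (hx : x ≠ []) (hy : y ≠ []) : SeqLT (omegaSeq (x ++ y)) (omegaSeq y) := by
  have hx' := List.length_pos_iff.2 hx
  have hy' := List.length_pos_iff.2 hy
  have h1 := h.2 x.length hx' (by simp; omega)
  rw [List.rotate_append_length_eq, altLT_iff (by simp [hx]) (by simp [hx])] at h1
  refine seqLT_of_append_comm h.1 hy ?_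
  rw [← List.append_assoc]
  exact h1.append h.1 (by simp; omega) y y

theorem not_seqLT_append [LinearOrder α] {a b : List α} (ha : a ≠ []) (hb : b ≠ [])
    (h : ¬ SeqLT (omegaSeq a) (omegaSeq b)) : ¬ SeqLT (omegaSeq (a ++ b)) (omegaSeq b) := by
  intro h'
  have hab : a ++ b ≠ [] := by simp [ha]
  rw [← seqLT_append_comm_iff hab hb, ← List.append_assoc] at h'
  by_cases e : omegaSeq (a ++ b) = omegaSeq (b ++ a)
  · have h2 : a ++ b = b ++ a := by
      apply List.ext_getElem?
      intro i
      rcases lt_or_ge i (a.length + b.length) with hi | hi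
      · have := congrFun e i
        simp only [omegaSeq, omegaLetter, List.length_append] at this
        rwa [Nat.mod_eq_of_lt hi, Nat.mod_eq_of_lt (by omega)] at this
      · rw [List.getElem?_eq_none (by simp; omega), List.getElem?_eq_none (by simp; omega)]
    rw [h2] at h'
    exact SeqLT.irrefl h'
  · rcases SeqLT.total e with h1 | h1
    · exact h (seqLT_of_append_comm ha hb h1)
    · exact h'.asymm (h1.append (by simp [ha]) (by simp; omega) b b)

/-- The factors are absorbed from the left: y ≽ g gives yg ≽ g, so yg can replace y in front of the
rest of the chain. -/
theorem not_seqLT_append_flatten [LinearOrder α] (G : List (List α)) (y : List α)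
    (hne : ∀ W ∈ y :: G, W ≠ []) (hc : (y :: G).IsChain (fun A B => AltLE B A)) :
    ¬ SeqLT (omegaSeq (y ++ G.flatten)) (omegaSeq ((y :: G).getLast (by simp))) := by
  induction G generalizing y with
  | nil => simpa using SeqLT.irrefl
  | cons g G ih =>
    have hy := hne y (by simp)
    have hg := hne g (by simp)
    rw [List.isChain_cons_cons, altLE_iff hg hy] at hc
    have h1 := not_seqLT_append hy hg hc.1
    have hc' : ((y ++ g) :: G).IsChain (fun A B => AltLE B A) := by
      cases G with
      | nil => simp
      | cons g' G =>
        have hg' := hne g' (by simp)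
        rw [List.isChain_cons_cons] at hc ⊢
        refine ⟨?_, hc.2.2⟩
        rw [altLE_iff hg' (by simp [hy])]
        exact not_seqLT_trans h1 ((altLE_iff hg' hg).1 hc.2.1)
    have h2 := ih (y ++ g) (by
      intro W hW
      rcases List.mem_cons.1 hW with rfl | hW
      · simp [hy]
      · exact hne W (by simp [hW])) hc'
    cases G with
    | nil => simpa using h1
    | cons g' G => simpa using h2

theorem IsGaloisFactorization.not_seqLT_getLast [LinearOrder α] {T : List α} {G : List (List α)}
    (h : IsGaloisFactorization T G) (hG : G ≠ []) {S : List α} (hS : S ≠ []) (hST : S <:+ T) :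
    ¬ SeqLT (omegaSeq S) (omegaSeq (G.getLast hG)) := by
  induction G generalizing T with
  | nil => exact absurd rfl hG
  | cons g G ih =>
    obtain ⟨rfl, hgal, hc⟩ := h
    obtain ⟨t, ht⟩ := hST
    rw [List.flatten_cons] at ht
    have hg := hgal g (by simp)
    have hGne : ∀ W ∈ G, W ≠ [] := fun W hW => (hgal W (by simp [hW])).1
    -- A suffix starting inside g begins with a suffix y of g, and y ≽ g keeps the chain descending.
    have key : ∀ x y, g = x ++ y → y ≠ [] → S = y ++ G.flatten →
        ¬ SeqLT (omegaSeq S) (omegaSeq ((g :: G).getLast hG)) := by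
      rintro x y hxy hy rfl
      have hyg : ¬ SeqLT (omegaSeq y) (omegaSeq g) := by
        by_cases hx : x = []
        · subst hx; rw [hxy]; simpa using SeqLT.irrefl
        · rw [hxy] at hg ⊢
          exact (hg.seqLT_suffix hx hy).asymm
      cases G with
      | nil => simpa using hyg
      | cons g' G =>
        rw [List.isChain_cons_cons] at hc
        have := not_seqLT_append_flatten (g' :: G) y (by
          intro W hW
          rcases List.mem_cons.1 hW with rfl | hW
          · exact hy
          · exact hGne W hW) (by
          rw [List.isChain_cons_cons]
          refine ⟨?_, hc.2⟩
          have hg' := hGne g' (by simp)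
          rw [altLE_iff hg' hy]
          exact not_seqLT_trans hyg ((altLE_iff hg' hg.1).1 hc.1))
        simpa using this
    rcases List.append_eq_append_iff.1 ht with ⟨c, hc1, hc2⟩ | ⟨c, hc1, hc2⟩
    · by_cases hcn : c = []
      · subst hcn
        simp only [List.append_nil, List.nil_append] at hc1 hc2
        have hGn : G ≠ [] := by rintro rfl; simp at hc2; exact hS hc2
        rw [List.getLast_cons hGn]
        exact ih ⟨rfl, fun W hW => hgal W (by simp [hW]), hc.of_cons⟩ hGn ⟨[], by simp [hc2]⟩
      · exact key t c hc1 hcn hc2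
    · have hGn : G ≠ [] := by
        rintro rfl
        simp at hc2
        exact hS hc2.2
      rw [List.getLast_cons hGn]
      exact ih ⟨rfl, fun W hW => hgal W (by simp [hW]), hc.of_cons⟩ hGn ⟨c, hc2.symm⟩

theorem IsGaloisFactorization.unique [LinearOrder α] {T : List α} {G H : List (List α)}
    (hG : IsGaloisFactorization T G) (hH : IsGaloisFactorization T H) : H = G := by
  induction G using List.reverseRecOn generalizing T H with
  | nil =>
    obtain ⟨rfl, -, -⟩ := hG
    cases H with
    | nil => rfl
    | cons W H =>
      have h1 := hH.1
      simp only [List.flatten_cons, List.flatten_nil, List.append_eq_nil_iff] at h1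
      exact absurd h1.1 (hH.2.1 W (by simp)).1
  | append_singleton G g ih =>
    have hg := hG.2.1 g (by simp)
    have hTg : G.flatten ++ g = T := by simpa using hG.1
    rcases List.eq_nil_or_concat H with rfl | ⟨H, h, rfl⟩
    · have := hH.1
      rw [← hTg] at this
      simp at this
      exact absurd this.2 hg.1
    rw [List.concat_eq_append] at hH ⊢
    have hh := hH.2.1 h (by simp)
    have hTh : H.flatten ++ h = T := by simpa using hH.1
    have e1 := hG.not_seqLT_getLast (by simp) hh.1 ⟨H.flatten, hTh⟩
    have e2 := hH.not_seqLT_getLast (by simp) hg.1 ⟨G.flatten, hTg⟩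
    rw [List.getLast_append_singleton] at e1 e2
    have suff : ∀ {x a b : List α}, b = x ++ a → a ≠ [] → IsGalois b →
        ¬ SeqLT (omegaSeq b) (omegaSeq a) → x = [] := by
      intro x a b hb ha hgal hlt
      by_contra hx
      subst hb
      exact hlt (hgal.seqLT_suffix hx ha)
    have hgh : G.flatten = H.flatten ∧ g = h := by
      rcases List.append_eq_append_iff.1 (hTg.trans hTh.symm) with ⟨c, hc1, hc2⟩ | ⟨c, hc1, hc2⟩
      · have := suff hc2 hh.1 hg e2
        subst this; simp_all
      · have := suff hc2 hg.1 hh e1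
        subst this; simp_all
    obtain ⟨hfl, rfl⟩ := hgh
    rw [ih (T := G.flatten) (H := H)
      ⟨rfl, fun W hW => hG.2.1 W (by simp [hW]), (List.isChain_append.1 hG.2.2).1⟩
      ⟨hfl.symm, fun W hW => hH.2.1 W (by simp [hW]), (List.isChain_append.1 hH.2.2).1⟩]

end GaloisWord
namespace GaloisWord

variable {α : Type*}

/-! ### Periods of pre-Galois prefixes. -/

section Periods

variable {β : Type*} {w : ℕ → β} {n m p q : ℕ}

/-- `p` is a period of the prefix of length `n` of `w`. -/
def Per (w : ℕ → β) (n p : ℕ) : Prop := ∀ i, i + p < n → w (i + p) = w i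

/-- `p` is the least period of the prefix of length `n` of `w` among the periods of its parity. -/
def LeastPer (w : ℕ → β) (n p : ℕ) : Prop :=
  0 < p ∧ Per w n p ∧ ∀ q, 0 < q → q < p → q % 2 = p % 2 → ¬ Per w n q

/-- The prefix of length `n` of `w` is pre-Galois. -/
def PG [LinearOrder β] (w : ℕ → β) (n : ℕ) : Prop :=
  ∀ p b, 0 < p → b + p < n → Per w (b + p) p → ¬ altRel b (w (b + p)) (w b)

theorem Per.mono (h : Per w n p) (hm : m ≤ n) : Per w m p := fun i hi => h i (by omega)

theorem Per.mul (h : Per w n p) (k i : ℕ) (hi : i + k * p < n) : w (i + k * p) = w i := by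
  induction k with
  | zero => simp
  | succ k ih =>
    rw [Nat.succ_mul, ← add_assoc] at hi ⊢
    rw [h _ hi, ih (by omega)]

theorem Per.of_mod_eq (h : Per w n p) {i j : ℕ} (hi : i < n) (hj : j < n) (hij : i % p = j % p) :
    w i = w j := by
  have h1 := h.mul (i / p) (i % p) (by rwa [Nat.mod_add_div'])
  have h2 := h.mul (j / p) (j % p) (by rwa [Nat.mod_add_div'])
  rw [Nat.mod_add_div'] at h1 h2
  rw [h1, h2, hij]

theorem Per.of_dvd (h : Per w n p) (hpq : p ∣ q) : Per w n q := by
  intro i hi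
  obtain ⟨k, rfl⟩ := hpq
  rw [mul_comm] at hi ⊢
  exact h.mul k i hi

theorem Per.sub (hp : Per w n p) (hq : Per w n q) (hpq : p ≤ q) : Per w (n - p) (q - p) := by
  intro i hi
  rw [← hp _ (by omega), ← hq i (by omega)]
  congr 1; omega

theorem per_succ (h : Per w n p) (hw : w n = w (n - p)) : Per w (n + 1) p := by
  intro i hi
  rcases Nat.lt_succ_iff_lt_or_eq.1 hi with h1 | h1
  · exact h i h1
  · rw [h1, hw, ← h1, Nat.add_sub_cancel]

theorem per_of_le (h : n ≤ p) : Per w n p := fun i hi => by omega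

theorem exists_mismatch (h : ¬ Per w n p) :
    ∃ b, b + p < n ∧ Per w (b + p) p ∧ w (b + p) ≠ w b := by
  classical
  have hex : ∃ b, b + p < n ∧ w (b + p) ≠ w b := by
    simpa [Per] using h
  refine ⟨Nat.find hex, (Nat.find_spec hex).1, fun i hi => ?_, (Nat.find_spec hex).2⟩
  have := Nat.find_min hex (m := i) (by omega)
  have hlt := (Nat.find_spec hex).1
  by_contra hne
  exact this ⟨by omega, hne⟩

theorem LeastPer.succ_of_per (h : LeastPer w n p) (h' : Per w (n + 1) p) :
    LeastPer w (n + 1) p :=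
  ⟨h.1, h', fun q h0 hq hpar hper => h.2.2 q h0 hq hpar (hper.mono (by omega))⟩

theorem LeastPer.le_of_per (h : LeastPer w n p) (hq : Per w n q) (h0 : 0 < q)
    (hpar : q % 2 = p % 2) : p ≤ q := by
  by_contra! hlt
  exact h.2.2 q h0 hlt hpar hq

theorem LeastPer.le_add_two (h : LeastPer w n p) :
    p ≤ n + 2 := by
  rcases Nat.mod_two_eq_zero_or_one p with h1 | h1 <;>
    rcases Nat.mod_two_eq_zero_or_one (n + 1) with h2 | h2
  · exact (h.le_of_per (per_of_le (Nat.le_succ n)) (by omega) (by omega)).trans (by omega)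
  · exact h.le_of_per (per_of_le (by omega)) (by omega) (by omega)
  · exact h.le_of_per (per_of_le (by omega)) (by omega) (by omega)
  · exact (h.le_of_per (per_of_le (Nat.le_succ n)) (by omega) (by omega)).trans (by omega)

theorem leastPer_zero (h0 : 0 < p) (h2 : p ≤ 2) : LeastPer w 0 p :=
  ⟨h0, per_of_le (Nat.zero_le _), fun q h3 h4 h5 => by omega⟩

variable [LinearOrder β]

theorem PG.mono (h : PG w n) (hm : m ≤ n) : PG w m := fun p b hp hb => h p b hp (by omega)

theorem PG.exists_mismatch (h : PG w n) (hp : 0 < p) (hper : ¬ Per w n p) :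
    ∃ b, b + p < n ∧ Per w (b + p) p ∧ altRel b (w b) (w (b + p)) := by
  obtain ⟨b, hb, hb', hne⟩ := GaloisWord.exists_mismatch hper
  exact ⟨b, hb, hb', altRel_of_not (h p b hp hb hb') hne⟩

theorem PG.compare_periods (h : PG w n) (hp : Per w n p) (hq : Per w n q) (h0 : 0 < p)
    (hpq : p < q) (hqn : q ≤ n) : ¬ altRel (n - q) (w (n - p)) (w (n - q)) := by
  have h1 := h (q - p) (n - q) (by omega) (by omega) ((hp.sub hq hpq.le).mono (by omega))
  rwa [show n - q + (q - p) = n - p by omega] at h1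

/-- A longer period q of the same parity cannot survive: its prediction at n is at most that of p,
which the new letter exceeds. Only periods longer than n remain. -/
theorem LeastPer.succ_of_mismatch (hPG : PG w n) (h : LeastPer w n p) (hpn : p ≤ n)
    (hgt : altRel (n - p) (w (n - p)) (w n)) (hm : n < m) (hm' : m ≤ n + 2)
    (hpar : m % 2 = p % 2) : LeastPer w (n + 1) m := by
  refine ⟨by omega, per_of_le hm, fun q h0 hq hqpar hper => ?_⟩
  have hqn : q ≤ n := by omega
  have hpern := hper.mono (Nat.le_succ n)
  have hpq := h.le_of_per hpern h0 (by omega)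
  have hw : w n = w (n - q) := by
    have := hper (n - q) (by omega)
    rwa [Nat.sub_add_cancel hqn] at this
  rcases eq_or_lt_of_le hpq with rfl | hlt
  · rw [hw] at hgt; exact altRel_irrefl hgt
  · rw [hw, altRel_congr (c := n - q) (by omega)] at hgt
    exact hPG.compare_periods h.2.1 hpern h.1 hlt hqn hgt

/-- A violation at the new letter through a period r would also violate the least period of the
parity of r, whose prediction is at least as large. -/
theorem PG.succ (hPG : PG w n) (hp : LeastPer w n p) (hq : LeastPer w n q)
    (hpq : p % 2 ≠ q % 2)
    (hp' : p ≤ n → ¬ altRel (n - p) (w n) (w (n - p)))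
    (hq' : q ≤ n → ¬ altRel (n - q) (w n) (w (n - q))) : PG w (n + 1) := by
  intro r b h0 hb hper hlt
  rcases Nat.lt_succ_iff_lt_or_eq.1 hb with hb' | rfl
  · exact hPG r b h0 hb' hper hlt
  have key : ∀ t, LeastPer w (b + r) t → t % 2 = r % 2 →
      (t ≤ b + r → ¬ altRel (b + r - t) (w (b + r)) (w (b + r - t))) → False := by
    intro t ht hpar hnot
    have htr := ht.le_of_per hper h0 hpar.symm
    rcases eq_or_lt_of_le htr with rfl | hltr
    · refine hnot (by omega) ?_
      rwa [Nat.add_sub_cancel]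
    · have h1 := hPG.compare_periods ht.2.1 hper ht.1 hltr (by omega)
      rw [Nat.add_sub_cancel] at h1
      refine hnot (by omega) ?_
      rw [altRel_congr (c := b) (by omega)]
      exact hlt.trans_not h1
  rcases Nat.mod_two_eq_zero_or_one p with h2 | h2 <;>
    rcases Nat.mod_two_eq_zero_or_one q with h3 | h3 <;>
      rcases Nat.mod_two_eq_zero_or_one r with h4 | h4 <;>
        first
          | omega
          | exact key p hp (by omega) hp'
          | exact key q hq (by omega) hq'

/-- A smaller period q of the same parity that breaks exactly at the last letter would break
upwards, so p would predict a larger letter than some shorter q, against `PG.compare_periods`. -/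
theorem LeastPer.pred (hPG : PG w (n + 1)) (h : LeastPer w (n + 1) p) (hpn : p ≤ n) :
    LeastPer w n p := by
  refine ⟨h.1, h.2.1.mono (by omega), fun q h0 hq hpar hper => ?_⟩
  have hne : w n ≠ w (n - q) := fun e => h.2.2 q h0 hq hpar (per_succ hper e)
  have h1 := hPG q (n - q) h0 (by omega) (by rwa [Nat.sub_add_cancel (by omega)])
  rw [Nat.sub_add_cancel (by omega)] at h1
  have h2 := altRel_of_not h1 hne
  have h3 := h.2.1 (n - p) (by omega)
  rw [Nat.sub_add_cancel hpn] at h3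
  rw [h3, altRel_congr (c := n - p) (by omega)] at h2
  exact (hPG.mono (Nat.le_succ n)).compare_periods hper (h.2.1.mono (Nat.le_succ n)) h0 hq hpn h2

theorem LeastPer.prefix (hPG : PG w n) (h : LeastPer w n p) (hpm : p ≤ m) (hmn : m ≤ n) :
    LeastPer w m p := by
  obtain ⟨k, rfl⟩ := Nat.exists_eq_add_of_le hmn
  induction k with
  | zero => exact h
  | succ k ih =>
    rw [← add_assoc] at hPG h
    exact ih (hPG.mono (by omega)) (h.pred hPG (by omega)) (by omega)

/-- No even period fits twice between an odd least period and the whole word. -/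
theorem LeastPer.no_even_period (hPG : PG w n) (h : LeastPer w n p) (hodd : p % 2 = 1)
    {r : ℕ} (hr : r < 2 * p) (hrn : r + p ≤ n) (h0 : 0 < q) (hqr : q ≤ r) (heven : q % 2 = 0) :
    ¬ Per w n q := by
  intro hq
  -- The difference of p and q is an odd period, smaller than p, of a prefix on which p is still the
  -- least odd period.
  rcases lt_trichotomy q p with hlt | rfl | hlt
  · have := (h.prefix hPG (m := n - q) (by omega) (by omega)).le_of_per
      (hq.sub h.2.1 hlt.le) (by omega) (by omega)
    omega
  · omega
  · have := (h.prefix hPG (m := n - p) (by omega) (by omega)).le_of_per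
      (h.2.1.sub hq hlt.le) (by omega) (by omega)
    omega

end Periods

/-! ### Galois roots, and why later factors are smaller. -/

theorem omegaSeq_rotate (u : List α) (k i : ℕ) : omegaSeq (u.rotate k) i = omegaSeq u (i + k) := by
  by_cases hu : u = []
  · subst hu; rfl
  · have : i % u.length < u.length := Nat.mod_lt _ (List.length_pos_iff.2 hu)
    simp only [omegaSeq, omegaLetter, List.length_rotate]
    rw [List.getElem?_rotate this, Nat.mod_add_mod]

/-- If k is not a period, the rotation by k loses to u before it wraps around. If k is a period, its
parity differs from that of p, and after p - k letters the comparison becomes one of u with its own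
shift by p - k. That shift is odd, so the sense is reversed, in favour of u once more. It does meet
a mismatch: otherwise doubling the smaller of k and p - k gives a period of the parity of p below p,
or u is a square. -/
theorem LeastPer.isGalois [LinearOrder α] {u : List α} {p : ℕ} (hlen : u.length = p)
    (hPG : PG (omegaSeq u) p) (h : LeastPer (omegaSeq u) p p)
    (hsq : ∀ q, p = 2 * q → ¬ Per (omegaSeq u) p q) : IsGalois u := by
  have hu : u ≠ [] := by rintro rfl; exact h.1.ne hlen
  refine ⟨hu, fun k hk hkp => ?_⟩
  rw [hlen] at hkp
  rw [altLT_iff hu (by simpa using hu)]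
  by_cases hper : Per (omegaSeq u) p k
  · have hwrap : ∀ i, omegaSeq (u.rotate k) (i + (p - k)) = omegaSeq u i := by
      intro i
      rw [omegaSeq_rotate, show i + (p - k) + k = i + u.length by omega, omegaSeq_add_length]
    have hkpar : k % 2 ≠ p % 2 := fun e => h.2.2 k hk hkp e hper
    have hper' : ¬ Per (omegaSeq u) p (p - k) := by
      intro hper'
      have hpar' : (p - k) % 2 ≠ p % 2 := fun e => h.2.2 (p - k) (by omega) (by omega) e hper'
      rcases lt_trichotomy (2 * k) p with hlt | heq | hlt
      · exact h.2.2 (2 * k) (by omega) hlt (by omega) (hper.of_dvd (Dvd.intro_left _ rfl))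
      · exact hsq k heq.symm hper
      · exact h.2.2 (2 * (p - k)) (by omega) (by omega) (by omega)
          (hper'.of_dvd (Dvd.intro_left _ rfl))
    obtain ⟨b, hb, hbper, hlt⟩ := hPG.exists_mismatch (by omega) hper'
    refine ⟨b + (p - k), fun i hi => ?_, ?_⟩
    · rcases lt_or_ge i (p - k) with h1 | h1
      · rw [omegaSeq_rotate, hper i (by omega)]
      · obtain ⟨i, rfl⟩ := Nat.exists_eq_add_of_le' h1
        rw [hwrap, hbper i hi]
    · rw [hwrap, altRel_flip (c := b) (by omega)]
      exact hlt
  · obtain ⟨b, hb, hbper, hlt⟩ := hPG.exists_mismatch hk hper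
    refine ⟨b, fun i hi => ?_, ?_⟩
    · rw [omegaSeq_rotate, hbper i (by omega)]
    · rwa [omegaSeq_rotate]

/-- Every factor that can be split off from the front of the text `w` is smaller than `u`. -/
def NextLT [LinearOrder α] (u : List α) (w : ℕ → WithBot α) : Prop :=
  ∀ n p v, PG w n → LeastPer w n p → p ≤ n → altRel (n - p) (w n) (w (n - p)) →
    (∀ i < n, omegaSeq v i = w i) → (∀ i, omegaSeq v (i + p) = omegaSeq v i) →
    SeqLT (omegaSeq v) (omegaSeq u)

/-- The shifted sequence copies w for r letters and then drops below it. What matters is whether the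
later failure, after n letters, comes before, at or behind this drop. -/
theorem nextLT_of_mismatch [LinearOrder α] {u : List α} {w : ℕ → WithBot α} {r D : ℕ}
    (hPG : PG w (r + D)) (hu : ∀ i < r + D, omegaSeq u i = w i) (hD : 0 < D)
    (hshift : ∀ i < r, w (i + D) = w i) (hlt : altRel r (w (r + D)) (w r))
    (hno : ∀ p, 0 < p → p ≤ r → p % 2 = 0 → ¬ Per w (r + D) p) :
    NextLT u (fun i => w (i + D)) := by
  intro n p v hPG' hp hpn hfail hv hvp
  have hper : ∀ k ≤ r, Per (fun i => w (i + D)) k p → Per w k p := by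
    intro k hk h i hi
    have := h i hi
    simp only at this
    rwa [hshift _ (by omega), hshift _ (by omega)] at this
  have h0 := hp.1
  rcases lt_trichotomy n r with hnr | rfl | hnr
  -- Before the drop, the failure would already occur inside w.
  · simp only at hfail
    rw [hshift _ hnr, hshift _ (by omega)] at hfail
    refine absurd ?_ (hPG p (n - p) h0 (by omega) ?_)
    · rwa [Nat.sub_add_cancel hpn]
    · rw [Nat.sub_add_cancel hpn]
      exact hper n (by omega) hp.2.1
  · simp only at hfail
    rw [hshift (n - p) (by omega)] at hfail
    have hpern := hper n le_rfl hp.2.1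
    have hle := hPG p (n - p) h0 (by omega) (by rwa [Nat.sub_add_cancel hpn])
    rw [Nat.sub_add_cancel hpn] at hle
    rcases Nat.mod_two_eq_zero_or_one p with heven | hodd
    -- Even p: the repetition of v keeps following w until w itself breaks the period p, at b + p ≥
    -- n, and w breaks it upwards.
    · obtain ⟨b, hb, hbper, hbm⟩ := hPG.exists_mismatch h0 (hno p h0 hpn heven)
      have hbn : n ≤ b + p := by
        by_contra! hc
        have := hpern b hc
        rw [this] at hbm
        exact altRel_irrefl hbm
      have hvw : ∀ i < b + p, omegaSeq v i = w i := by
        intro i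
        induction i using Nat.strong_induction_on with
        | _ i ih =>
          intro hi
          rcases lt_or_ge i n with h1 | h1
          · rw [hv i h1]; exact hshift i h1
          · obtain ⟨j, rfl⟩ := Nat.exists_eq_add_of_le' (hpn.trans h1)
            rw [hvp, ih j (by omega) (by omega), hbper j hi]
      refine ⟨b + p, fun i hi => ?_, ?_⟩
      · rw [hvw i hi, hu i (by omega)]
      · rw [hu _ hb, hvp, hvw b (by omega), altRel_congr (c := b) (by omega)]
        exact hbm
    -- Odd p: the orders at n and n - p are opposite, so the drop and the failure together put w n
    -- below w (n - p), against `hle`.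
    · rw [altRel_flip (c := n - p) (by omega)] at hlt
      exact absurd (hlt.trans hfail) hle
  · refine ⟨r, fun i hi => ?_, ?_⟩
    · rw [hv i (by omega), hu i (by omega)]; exact hshift i hi
    · rw [hv r hnr, hu r (by omega)]
      exact hlt

/-- The length `l` of the factors that are split off when the period `p` fails; `q` is the least
period of the other parity. -/
def FactorLength (p q l : ℕ) : Prop :=
  (p % 2 = 0 ∧ p ≠ 2 * q ∧ l = p) ∨ (p = 2 * q ∧ l = q) ∨ (p % 2 = 1 ∧ l = p)

section Factor

variable {w : ℕ → WithBot α} {n p q l D : ℕ} {u : List α}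

theorem FactorLength.dvd (h : FactorLength p q l) : l ∣ p := by
  rcases h with h | h | h
  · rw [h.2.2]
  · rw [h.1, h.2]; exact Dvd.intro_left _ rfl
  · rw [h.2]

theorem FactorLength.leastPer (h : FactorLength p q l) (hp : LeastPer w n p)
    (hq : LeastPer w n q) : LeastPer w n l := by
  rcases h with h | h | h
  · rwa [h.2.2]
  · rwa [h.2]
  · rwa [h.2]

theorem omegaSeq_eq_of_per (hl : Per w n l) (hl0 : 0 < l) (hln : l ≤ n) (hul : u.length = l)
    (hu : ∀ i < l, omegaSeq u i = w i) : ∀ i < n, omegaSeq u i = w i := by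
  intro i hi
  have h1 : i % l < l := Nat.mod_lt _ hl0
  rw [← omegaSeq_mod, hul, hu _ h1]
  exact hl.of_mod_eq (by omega) hi (Nat.mod_mod _ _)

theorem omegaSeq_add_of_dvd (hul : u.length ∣ p) (i : ℕ) :
    omegaSeq u (i + p) = omegaSeq u i := by
  obtain ⟨k, rfl⟩ := hul
  rw [← omegaSeq_mod, ← omegaSeq_mod u i, Nat.add_mul_mod_self_left]

variable [LinearOrder α]

theorem isGalois_of_factorLength (hPG : PG w n) (hp : LeastPer w n p) (hq : LeastPer w n q)
    (hpq : p % 2 ≠ q % 2) (hpn : p ≤ n) (hcase : FactorLength p q l)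
    (hul : u.length = l) (hu : ∀ i < l, omegaSeq u i = w i) : IsGalois u := by
  have hl := hcase.leastPer hp hq
  have hl0 := hl.1
  have hln : l ≤ n := (Nat.le_of_dvd hp.1 hcase.dvd).trans hpn
  have hper_congr : ∀ t, Per (omegaSeq u) l t ↔ Per w l t := by
    intro t
    constructor <;> intro h i hi
    · rw [← hu _ (by omega), ← hu _ (by omega)]; exact h i hi
    · rw [hu _ (by omega), hu _ (by omega)]; exact h i hi
  have hll := hl.prefix hPG (m := l) le_rfl hln
  refine LeastPer.isGalois hul ?_ ⟨hl0, (hper_congr _).2 hll.2.1,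
    fun t h1 h2 h3 h4 => hll.2.2 t h1 h2 h3 ((hper_congr _).1 h4)⟩ ?_
  · intro t b ht hb hbper
    rw [hu _ (by omega), hu _ (by omega)]
    refine hPG t b ht (by omega) fun i hi => ?_
    rw [← hu _ (by omega), ← hu _ (by omega)]
    exact hbper i hi
  · rintro t rfl hper
    rw [hper_congr] at hper
    have htn : Per w n t := by
      intro i hi
      have h1 : (i + t) % (2 * t) < 2 * t := Nat.mod_lt _ hl0
      have h2 : i % (2 * t) < 2 * t := Nat.mod_lt _ hl0
      rw [hl.2.1.of_mod_eq hi (j := (i + t) % (2 * t)) (by omega) (Nat.mod_mod _ _).symm,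
        hl.2.1.of_mod_eq (i := i) (by omega) (j := i % (2 * t)) (by omega) (Nat.mod_mod _ _).symm]
      refine hper.of_mod_eq h1 h2 ?_
      rw [Nat.mod_mod_of_dvd _ (Dvd.intro_left _ rfl), Nat.mod_mod_of_dvd _ (Dvd.intro_left _ rfl),
        Nat.add_mod_right]
    have htpar : t % 2 = 1 := by
      by_contra hc
      have := hl.le_of_per htn (by omega) (by omega)
      omega
    -- With p = 2t and t an odd period, q ≤ t and p ≤ 2q give p = 2q, which this case excludes. In
    -- the other cases l is odd.
    rcases hcase with ⟨h1, h2, h3⟩ | ⟨h1, h2⟩ | ⟨h1, h2⟩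
    · have h5 := hq.le_of_per htn (by omega) (by omega)
      have h6 := hp.le_of_per (hq.2.1.of_dvd (Dvd.intro_left 2 rfl)) (by omega) (by omega)
      omega
    · omega
    · omega

/-- Since D has the parity of p, the failure of p reads as a drop below w at r = n - D. Even periods
up to r are excluded by leastness if p is even, and by `LeastPer.no_even_period` if p is odd; the
latter tolerates r < 2p. -/
theorem nextLT_of_factorLength (hPG : PG w n) (hp : LeastPer w n p) (hq : LeastPer w n q)
    (hpn : p ≤ n) (hfail : altRel (n - p) (w n) (w (n - p))) (hcase : FactorLength p q l)
    (hlD : l ∣ D) (hD : 0 < D) (hDn : D ≤ n) (hDpar : D % 2 = p % 2)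
    (hDlt : n < D + p ∨ p % 2 = 1 ∧ p ≤ D ∧ n < D + 2 * p) (hu : ∀ i < n, omegaSeq u i = w i) :
    NextLT u (fun i => w (i + D)) := by
  have h0 := hp.1
  have hl := hcase.leastPer hp hq
  obtain ⟨r, rfl⟩ := Nat.exists_eq_add_of_le' hDn
  have hDl : ∀ i, (i + D) % l = i % l := by
    obtain ⟨k, rfl⟩ := hlD
    intro i
    rw [Nat.add_mul_mod_self_left]
  refine nextLT_of_mismatch hPG hu hD (fun i hi => ?_) ?_ ?_
  · exact hl.2.1.of_mod_eq (by omega) (by omega) (hDl i)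
  · have hr : w (r + D - p) = w r := by
      refine hl.2.1.of_mod_eq (by omega) (by omega) ?_
      rw [← hDl r]
      obtain ⟨k, rfl⟩ := hcase.dvd
      conv_rhs => rw [← Nat.sub_add_cancel hpn, Nat.add_mul_mod_self_left]
    rw [hr, altRel_congr (c := r) (by omega)] at hfail
    exact hfail
  · intro t ht htr hteven hper
    rcases hDlt with h1 | ⟨h1, h2, h3⟩
    · by_cases hodd : p % 2 = 1
      · rcases le_or_gt p D with h4 | h4
        · exact hp.no_even_period hPG hodd (r := r) (by omega) (by omega) ht htr hteven hper
        · rcases hcase with h | h | h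
          · omega
          · omega
          · have := Nat.le_of_dvd hD hlD
            omega
      · have := hp.le_of_per hper ht (by omega)
        omega
    · exact hp.no_even_period hPG h1 (r := r) (by omega) (by omega) ht htr hteven hper

end Factor

end GaloisWord
namespace GaloisWord

/-! ### Suffixes of the text as sequences; the invariant of the scan. -/

variable {α : Type*}

/-- The suffix of `T` that starts at position `s`, followed by infinitely many least letters. -/
def tailSeq (T : List α) (s : ℕ) : ℕ → WithBot α := fun i => T[s + i]?

theorem tailSeq_shift (T : List α) (s D : ℕ) :
    (fun i => tailSeq T s (i + D)) = tailSeq T (s + D) := by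
  funext i
  simp only [tailSeq]
  rw [show s + (i + D) = s + D + i by omega]

theorem tailSeq_zero (T : List α) (s i : ℕ) : tailSeq T 0 (s + i) = tailSeq T s i := by
  simp only [tailSeq, Nat.zero_add]; rfl

theorem tailSeq_bot_lt [LinearOrder α] (T : List α) (s : ℕ) {n i : ℕ} (hn : s + n = T.length) (hi : i < n) :
    tailSeq T s n < tailSeq T s i := by
  have h1 : tailSeq T s n = ⊥ := by
    simp only [tailSeq]
    rw [List.getElem?_eq_none (by omega)]; rfl
  have h2 : tailSeq T s i = ((T[s + i] : α) : WithBot α) := by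
    simp only [tailSeq]
    rw [List.getElem?_eq_getElem (by omega)]; rfl
  rw [h1, h2]
  exact WithBot.bot_lt_coe _

section Factor

variable {T : List α} {s n l m : ℕ}

theorem omegaSeq_take_drop (h : s + l ≤ T.length) :
    ∀ i < l, omegaSeq ((T.drop s).take l) i = tailSeq T s i := by
  intro i hi
  have hlen : ((T.drop s).take l).length = l := by simp; omega
  simp only [omegaSeq, omegaLetter, tailSeq, hlen, Nat.mod_eq_of_lt hi]
  rw [List.getElem?_take_of_lt hi, List.getElem?_drop]

theorem take_drop_take (h : s + l ≤ m) : ((T.take m).drop s).take l = (T.drop s).take l := by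
  rw [List.drop_take, List.take_take, min_eq_left (by omega)]

theorem take_drop_eq_of_per (hper : Per (tailSeq T s) n l) {D : ℕ} (hlD : l ∣ D)
    (hD : D + l ≤ n) :
    (T.drop (s + D)).take l = (T.drop s).take l := by
  apply List.ext_getElem?
  intro i
  rcases lt_or_ge i l with hi | hi
  · rw [List.getElem?_take_of_lt hi, List.getElem?_take_of_lt hi, List.getElem?_drop,
      List.getElem?_drop, add_assoc]
    refine hper.of_mod_eq (i := D + i) (j := i) (by omega) (by omega) ?_
    obtain ⟨k, rfl⟩ := hlD
    rw [Nat.mul_add_mod]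
  · rw [List.getElem?_eq_none (by simp; omega), List.getElem?_eq_none (by simp; omega)]

theorem isPreGalois_of_PG [LinearOrder α] (hn : s + n ≤ T.length) (hPG : PG (tailSeq T s) n) :
    IsPreGalois ((T.drop s).take n) := by
  intro S hS hne
  set R := (T.drop s).take n with hR
  have hlen : R.length = n := by simp [hR]; omega
  have hRw := omegaSeq_take_drop hn
  rw [← hR] at hRw
  obtain ⟨p, hpS⟩ : ∃ p, S = R.drop p := ⟨_, List.suffix_iff_eq_drop.1 hS⟩
  subst hpS
  have hp0 : 0 < p := by
    rw [Nat.pos_iff_ne_zero]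
    rintro rfl
    simp at hne
  have hSi : ∀ i, (R.drop p)[i]? = R[i + p]? := fun i => by rw [List.getElem?_drop, add_comm]
  have hRi : ∀ i < n, R[i]? = tailSeq T s i := by
    intro i hi
    rw [← hRw i hi]
    simp only [omegaSeq, omegaLetter, hlen, Nat.mod_eq_of_lt hi]
  by_cases hper : Per (tailSeq T s) n p
  · left
    rw [List.prefix_iff_eq_take]
    apply List.ext_getElem?
    intro i
    have hdl : (R.drop p).length = n - p := by simp [hlen]
    rcases lt_or_ge i (n - p) with hi | hi
    · rw [hdl, List.getElem?_take_of_lt hi, hSi, hRi _ (by omega), hRi _ (by omega),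
        hper i (by omega)]
    · rw [List.getElem?_eq_none (by omega), List.getElem?_eq_none (by simp; omega)]
  · right
    obtain ⟨b, hb, hbper, hlt⟩ := hPG.exists_mismatch hp0 hper
    have hdl : (R.drop p).length = n - p := by simp [hlen]
    have hS' : ∀ i < n - p, omegaSeq (R.drop p) i = tailSeq T s (i + p) := by
      intro i hi
      simp only [omegaSeq, omegaLetter, hdl, Nat.mod_eq_of_lt hi]
      rw [hSi, hRi _ (by omega)]
    rw [altLT_iff (List.ne_nil_of_length_pos (by omega)) (List.ne_nil_of_length_pos (by omega))]
    refine ⟨b, fun i hi => ?_, ?_⟩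
    · rw [hRw i (by omega), hS' i (by omega), hbper i (by omega)]
    · rw [hRw b (by omega), hS' b (by omega)]
      exact hlt

end Factor

/-- `out` is a Galois factorization of the first `s` letters of `T`. -/
def Parsed [LinearOrder α] (T : List α) (s : ℕ) (out : List (List α)) : Prop :=
  IsGaloisFactorization (T.take s) out

theorem Parsed.append [LinearOrder α] {T : List α} {s l : ℕ} {out : List (List α)}
    (h : Parsed T s out) (hu : IsGalois ((T.drop s).take l))
    (hlast : ∀ v ∈ out.getLast?, ¬ SeqLT (omegaSeq v) (omegaSeq ((T.drop s).take l))) :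
    Parsed T (s + l) (out ++ [(T.drop s).take l]) := by
  obtain ⟨h1, h2, h3⟩ := h
  refine ⟨?_, ?_, ?_⟩
  · rw [List.flatten_append, h1, List.flatten_singleton, List.take_add]
  · intro W hW
    rcases List.mem_append.1 hW with hW | hW
    · exact h2 W hW
    · rw [List.mem_singleton.1 hW]; exact hu
  · rw [List.isChain_append]
    refine ⟨h3, by simp, fun v hv y hy => ?_⟩
    have hvne := (h2 v (List.mem_of_mem_getLast? hv)).1
    simp only [List.head?_cons, Option.mem_def, Option.some.injEq] at hy
    subst hy
    rw [altLE_iff hu.1 hvne]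
    exact hlast v hv

/-- The state of the scan: the first `s` letters are factorized, the `n` letters after them form a
pre-Galois word, and `m` letters are revealed. -/
structure ScanInv [LinearOrder α] (T : List α) (s n m : ℕ) (out : List (List α)) : Prop where
  le_length : m ≤ T.length
  add_le : s + n ≤ m
  parsed : Parsed T s out
  next : ∀ u ∈ out.getLast?, NextLT u (tailSeq T s)
  pg : PG (tailSeq T s) n

end GaloisWord
namespace OnlineRAM

open GaloisWord

/-! ### Reasoning about runs of the machine. -/

section Semantics

variable {α : Type*} [LinearOrder α] {k : ℕ}

theorem Reaches.head {P : Program k} {c d e : Config α k} {t w : ℕ}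
    (h : step P c = some (d, w)) (hr : Reaches P d t e) : Reaches P c (w + t) e := by
  induction hr with
  | refl =>
    have := Reaches.tail (Reaches.refl (P := P) (c := c)) h
    rwa [Nat.zero_add] at this
  | tail _ hs ih => rw [← add_assoc]; exact ih.tail hs

/-- The registers are bounded by `B`, and at every request the revealed text that is not yet
output is pre-Galois. -/
def Sound (P : Program k) (B : ℕ) (c : Config α k) : Prop :=
  (∀ r, c.reg r ≤ B) ∧
    (Requests P c → ∃ R : List α, c.seen = c.out.flatten ++ R ∧ IsPreGalois R)

/-- From the given configuration the program halts within the given time with an output satisfying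
`F`, through sound configurations only. -/
inductive Runs (P : Program k) (B : ℕ) (F : List (List α) → Prop) : Config α k → ℕ → Prop
  | halt {c : Config α k} {t : ℕ} :
      Halted P c → (∀ r, c.reg r ≤ B) → F c.out → Runs P B F c t
  | step {c d : Config α k} {w t t' : ℕ} :
      OnlineRAM.step P c = some (d, w) → Sound P B c → Runs P B F d t → w + t ≤ t' →
        Runs P B F c t'

variable {P : Program k} {B : ℕ} {F : List (List α) → Prop} {c : Config α k} {t : ℕ}

theorem Runs.mono (h : Runs P B F c t) {t' : ℕ} (ht : t ≤ t') : Runs P B F c t' := by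
  cases h with
  | halt h1 h2 h3 => exact .halt h1 h2 h3
  | step h1 h2 h3 h4 => exact .step h1 h2 h3 (h4.trans ht)

theorem Runs.reaches_halted (h : Runs P B F c t) :
    ∃ t' d, Reaches P c t' d ∧ Halted P d ∧ F d.out ∧ t' ≤ t := by
  induction h with
  | halt h1 h2 h3 => exact ⟨0, _, .refl, h1, h3, Nat.zero_le _⟩
  | step h1 _ _ h4 ih =>
    obtain ⟨t', d, h5, h6, h7, h8⟩ := ih
    exact ⟨_, d, h5.head h1, h6, h7, by omega⟩

theorem Runs.sound (h : Runs P B F c t) : Sound P B c := by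
  cases h with
  | halt h1 h2 _ =>
    refine ⟨h2, fun ⟨e, he⟩ => ?_⟩
    rw [Halted, he] at h1
    simp at h1
  | step _ h2 _ _ => exact h2

/-- Steps are deterministic, so each reachable configuration lies on the given run. -/
theorem Runs.of_reaches (h : Runs P B F c t) {t' : ℕ} {d : Config α k} (hr : Reaches P c t' d) :
    ∃ s, Runs P B F d s := by
  induction hr with
  | refl => exact ⟨t, h⟩
  | tail _ hs ih =>
    obtain ⟨s, hd⟩ := ih
    cases hd with
    | halt h1 _ _ =>
      rw [Halted] at h1
      rw [OnlineRAM.step, h1] at hs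
      simp at hs
    | step h1 _ h3 _ =>
      rw [hs] at h1
      simp only [Option.some.injEq, Prod.mk.injEq] at h1
      obtain ⟨rfl, rfl⟩ := h1
      exact ⟨_, h3⟩

variable {pc : ℕ} {reg : Fin k → ℕ} {seen rest : List α} {out : List (List α)}

theorem sound_of_instr {I : Instr k} (h : P[pc]? = some I) (hI : ∀ e, I ≠ .read e)
    (hB : ∀ r, reg r ≤ B) : Sound P B (⟨pc, reg, seen, rest, out⟩ : Config α k) := by
  refine ⟨hB, fun ⟨e, he⟩ => ?_⟩
  simp only [h, Option.some.injEq] at he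
  exact absurd he (hI e)

theorem update_le (hB : ∀ r, reg r ≤ B) (r : Fin k) {v : ℕ} (hv : v ≤ B) :
    ∀ i, Function.update reg r v i ≤ B := by
  intro i
  rcases eq_or_ne i r with rfl | h
  · simpa using hv
  · simpa [h] using hB i

theorem Runs.const {r : Fin k} {v : ℕ} (h : P[pc]? = some (.const r v)) (hB : ∀ i, reg i ≤ B)
    (hv : v ≤ B) (hn : (∀ i, Function.update reg r v i ≤ B) →
      Runs P B F ⟨pc + 1, Function.update reg r v, seen, rest, out⟩ t) :
    Runs P B F ⟨pc, reg, seen, rest, out⟩ (t + 1) :=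
  .step (w := 1) (by simp only [OnlineRAM.step, h]) (sound_of_instr h (by simp) hB)
    (hn (update_le hB r hv)) (by omega)

theorem Runs.copy {r a : Fin k} (h : P[pc]? = some (.copy r a)) (hB : ∀ i, reg i ≤ B)
    (hn : (∀ i, Function.update reg r (reg a) i ≤ B) →
      Runs P B F ⟨pc + 1, Function.update reg r (reg a), seen, rest, out⟩ t) :
    Runs P B F ⟨pc, reg, seen, rest, out⟩ (t + 1) :=
  .step (w := 1) (by simp only [OnlineRAM.step, h]) (sound_of_instr h (by simp) hB)
    (hn (update_le hB r (hB a))) (by omega)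

theorem Runs.add {r a b : Fin k} (h : P[pc]? = some (.add r a b)) (hB : ∀ i, reg i ≤ B)
    (hv : reg a + reg b ≤ B) (hn : (∀ i, Function.update reg r (reg a + reg b) i ≤ B) →
      Runs P B F ⟨pc + 1, Function.update reg r (reg a + reg b), seen, rest, out⟩ t) :
    Runs P B F ⟨pc, reg, seen, rest, out⟩ (t + 1) :=
  .step (w := 1) (by simp only [OnlineRAM.step, h]) (sound_of_instr h (by simp) hB)
    (hn (update_le hB r hv)) (by omega)

theorem Runs.sub {r a b : Fin k} (h : P[pc]? = some (.sub r a b)) (hB : ∀ i, reg i ≤ B)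
    (hn : (∀ i, Function.update reg r (reg a - reg b) i ≤ B) →
      Runs P B F ⟨pc + 1, Function.update reg r (reg a - reg b), seen, rest, out⟩ t) :
    Runs P B F ⟨pc, reg, seen, rest, out⟩ (t + 1) :=
  .step (w := 1) (by simp only [OnlineRAM.step, h]) (sound_of_instr h (by simp) hB)
    (hn (update_le hB r ((Nat.sub_le _ _).trans (hB a)))) (by omega)

theorem Runs.jle {a b : Fin k} {l : ℕ} (h : P[pc]? = some (.jle a b l)) (hB : ∀ i, reg i ≤ B)
    (h1 : reg a ≤ reg b → Runs P B F ⟨l, reg, seen, rest, out⟩ t)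
    (h2 : reg b < reg a → Runs P B F ⟨pc + 1, reg, seen, rest, out⟩ t) :
    Runs P B F ⟨pc, reg, seen, rest, out⟩ (t + 1) := by
  by_cases hab : reg a ≤ reg b
  · exact .step (w := 1) (by simp only [OnlineRAM.step, h, hab, if_true]) (sound_of_instr h (by simp) hB)
      (h1 hab) (by omega)
  · exact .step (w := 1) (by simp only [OnlineRAM.step, h, hab, if_false]) (sound_of_instr h (by simp) hB)
      (h2 (not_le.1 hab)) (by omega)

theorem Runs.jump {a : Fin k} {l : ℕ} (h : P[pc]? = some (.jle a a l)) (hB : ∀ i, reg i ≤ B)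
    (hn : Runs P B F ⟨l, reg, seen, rest, out⟩ t) :
    Runs P B F ⟨pc, reg, seen, rest, out⟩ (t + 1) :=
  .jle h hB (fun _ => hn) fun h => absurd h (lt_irrefl _)

theorem Runs.cmp {a b : Fin k} {lt gt m : ℕ} {T : List α} (h : P[pc]? = some (.cmp a b lt gt))
    (hB : ∀ i, reg i ≤ B) (ha : reg a < m) (hb : reg b < m) (hm : m ≤ T.length)
    (h1 : tailSeq T 0 (reg a) < tailSeq T 0 (reg b) →
      Runs P B F ⟨lt, reg, T.take m, rest, out⟩ t)
    (h2 : tailSeq T 0 (reg b) < tailSeq T 0 (reg a) →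
      Runs P B F ⟨gt, reg, T.take m, rest, out⟩ t)
    (h3 : tailSeq T 0 (reg a) = tailSeq T 0 (reg b) →
      Runs P B F ⟨pc + 1, reg, T.take m, rest, out⟩ t) :
    Runs P B F ⟨pc, reg, T.take m, rest, out⟩ (t + 1) := by
  have key : ∀ i, (hi : i < m) → (T.take m)[i]? = some T[i] ∧
      tailSeq T 0 i = ((T[i] : α) : WithBot α) := by
    intro i hi
    refine ⟨?_, ?_⟩
    · rw [List.getElem?_take_of_lt hi, List.getElem?_eq_getElem]
    · simp only [tailSeq, Nat.zero_add]
      rw [List.getElem?_eq_getElem (by omega)]; rfl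
  obtain ⟨ha1, ha2⟩ := key _ ha
  obtain ⟨hb1, hb2⟩ := key _ hb
  rw [ha2, hb2] at h1 h2 h3
  simp only [WithBot.coe_lt_coe, WithBot.coe_inj] at h1 h2 h3
  have hS : Sound P B (⟨pc, reg, T.take m, rest, out⟩ : Config α k) :=
    sound_of_instr h (by simp) hB
  rcases lt_trichotomy (T[reg a]) (T[reg b]) with hlt | heq | hlt
  · exact .step (w := 1) (by simp only [OnlineRAM.step, h, ha1, hb1, hlt, if_true]) hS (h1 hlt) (by omega)
  · exact .step (w := 1) (by simp only [OnlineRAM.step, h, ha1, hb1, heq, lt_irrefl, if_false]) hS (h3 heq)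
      (by omega)
  · exact .step (w := 1) (by simp only [OnlineRAM.step, h, ha1, hb1, hlt, hlt.not_gt, if_true, if_false]) hS
      (h2 hlt) (by omega)

theorem Runs.read {e m : ℕ} {T : List α} (h : P[pc]? = some (.read e)) (hB : ∀ i, reg i ≤ B)
    (hm : m ≤ T.length) (hR : ∃ R, T.take m = out.flatten ++ R ∧ IsPreGalois R)
    (h1 : m = T.length → Runs P B F ⟨e, reg, T.take m, T.drop m, out⟩ t)
    (h2 : m < T.length → Runs P B F ⟨pc + 1, reg, T.take (m + 1), T.drop (m + 1), out⟩ t) :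
    Runs P B F ⟨pc, reg, T.take m, T.drop m, out⟩ (t + 1) := by
  have hS : Sound P B (⟨pc, reg, T.take m, T.drop m, out⟩ : Config α k) := ⟨hB, fun _ => hR⟩
  rcases hm.eq_or_lt with rfl | hlt
  · refine .step ?_ hS (h1 rfl) (Nat.add_comm _ _).le
    simp only [OnlineRAM.step, h, List.drop_length]
  · refine .step ?_ hS (h2 hlt) (Nat.add_comm _ _).le
    rw [List.take_succ_eq_append_getElem hlt, List.drop_eq_getElem_cons hlt]
    simp only [OnlineRAM.step, h]

theorem Runs.emit {a b : Fin k} (h : P[pc]? = some (.emit a b)) (hB : ∀ i, reg i ≤ B)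
    (hab : reg a ≤ reg b) (hb : reg b ≤ seen.length)
    (hn : Runs P B F ⟨pc + 1, reg, seen, rest,
      out ++ [(seen.drop (reg a)).take (reg b - reg a)]⟩ t) :
    Runs P B F ⟨pc, reg, seen, rest, out⟩ (t + 1 + (reg b - reg a)) :=
  .step (w := 1 + (reg b - reg a)) (by simp only [OnlineRAM.step, h]; rw [if_pos ⟨hab, hb⟩]) (sound_of_instr h (by simp) hB)
    hn (by omega)

end Semantics

end OnlineRAM
-- The factorization program.
namespace OnlineRAM

open GaloisWord

/-- The registers of the factorization program: the start `s` and the end `e` of the remainder, the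
number `m` of revealed letters, the least periods `a` and `b` of the remainder with the parity of
its length and with the other parity, the parity `f` of that length, four auxiliary registers. -/
def regs (s e m a b f k x y o : ℕ) : Fin 10 → ℕ := ![s, e, m, a, b, f, k, x, y, o]

section Regs

variable (s e m a b f k x y o v : ℕ)

theorem regs_zero : regs s e m a b f k x y o 0 = s := rfl
theorem regs_one : regs s e m a b f k x y o 1 = e := rfl
theorem regs_two : regs s e m a b f k x y o 2 = m := rfl
theorem regs_three : regs s e m a b f k x y o 3 = a := rfl
theorem regs_four : regs s e m a b f k x y o 4 = b := rfl
theorem regs_five : regs s e m a b f k x y o 5 = f := rfl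
theorem regs_six : regs s e m a b f k x y o 6 = k := rfl
theorem regs_seven : regs s e m a b f k x y o 7 = x := rfl
theorem regs_eight : regs s e m a b f k x y o 8 = y := rfl
theorem regs_nine : regs s e m a b f k x y o 9 = o := rfl

theorem update_regs_zero :
    Function.update (regs s e m a b f k x y o) 0 v = regs v e m a b f k x y o := by
  funext i; fin_cases i <;> rfl

theorem update_regs_one :
    Function.update (regs s e m a b f k x y o) 1 v = regs s v m a b f k x y o := by
  funext i; fin_cases i <;> rfl

theorem update_regs_two :
    Function.update (regs s e m a b f k x y o) 2 v = regs s e v a b f k x y o := by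
  funext i; fin_cases i <;> rfl

theorem update_regs_three :
    Function.update (regs s e m a b f k x y o) 3 v = regs s e m v b f k x y o := by
  funext i; fin_cases i <;> rfl

theorem update_regs_four :
    Function.update (regs s e m a b f k x y o) 4 v = regs s e m a v f k x y o := by
  funext i; fin_cases i <;> rfl

theorem update_regs_five :
    Function.update (regs s e m a b f k x y o) 5 v = regs s e m a b v k x y o := by
  funext i; fin_cases i <;> rfl

theorem update_regs_six :
    Function.update (regs s e m a b f k x y o) 6 v = regs s e m a b f v x y o := by
  funext i; fin_cases i <;> rfl

theorem update_regs_seven :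
    Function.update (regs s e m a b f k x y o) 7 v = regs s e m a b f k v y o := by
  funext i; fin_cases i <;> rfl

theorem update_regs_eight :
    Function.update (regs s e m a b f k x y o) 8 v = regs s e m a b f k x v o := by
  funext i; fin_cases i <;> rfl

theorem update_regs_nine :
    Function.update (regs s e m a b f k x y o) 9 v = regs s e m a b f k x y v := by
  funext i; fin_cases i <;> rfl

end Regs

attribute [local simp] regs_zero regs_one regs_two regs_three regs_four regs_five regs_six
  regs_seven regs_eight regs_nine update_regs_zero update_regs_one update_regs_two
  update_regs_three update_regs_four update_regs_five update_regs_six update_regs_seven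
  update_regs_eight update_regs_nine

/-- The factorization program. Address 1 starts the scan of a new remainder, 5 is the head of the
scan, 24 requests a letter, and 33 splits off factors after the period in register `3` failed. -/
def galoisProgram : Program 10 :=
  [.const 9 1,
   .copy 1 0, .const 3 2, .const 4 1, .const 5 0,
   .add 6 1 9, .sub 6 6 0, .jle 2 1 24,
   .copy 8 3, .jle 6 3 14, .sub 7 1 3, .cmp 1 7 33 13, .jle 9 9 14, .add 8 6 9,
   .jle 6 4 19, .sub 7 1 4, .cmp 1 7 18 29, .jle 9 9 19, .copy 4 6,
   .copy 3 4, .copy 4 8, .sub 5 9 5, .add 1 1 9, .jle 9 9 5,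
   .read 27, .add 2 2 9, .jle 9 9 8,
   .jle 1 0 49, .jle 9 9 33,
   -- The failing period must be in register `3`: exchange the two periods and flip the parity flag.
   .copy 7 3, .copy 3 4, .copy 4 7, .sub 5 9 5,
   -- For even p, 2q is an even period, so p ≤ 2q and the test 2q ≤ p detects p = 2q.
   .jle 9 5 45, .add 7 4 4, .jle 7 3 37, .copy 4 3,
   .add 7 0 3, .jle 7 1 40, .jle 9 9 1,
   .add 8 0 4, .emit 0 8, .copy 0 8, .jle 7 0 37, .jle 9 9 40,
   -- For odd p one copy of the root goes out first; after that only blocks of even length 2p do.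
   .copy 4 3, .add 7 0 3, .add 3 3 3, .jle 9 9 40,
   .halt]

/-! ### Splitting off factors: correctness and cost. -/

variable {α : Type*} [LinearOrder α] {T : List α} {B : ℕ} {F : List (List α) → Prop}
  {s n m t : ℕ} {out : List (List α)} {u : List α}

/-- A round takes at most five instructions plus l letters of output, hence at most 6l time as l ≥
1. -/
theorem runs_emit_loop {e a l f k x : ℕ} (hem : e ≤ m) (hm : m ≤ T.length) (hl : 0 < l)
    (hu : IsGalois u) (hBe : e ≤ B)
    (hfin : ∀ y out', Parsed T x out' → out'.getLast? = some u →
      (∀ r, regs x e m a l f k x y 1 r ≤ B) →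
      Runs galoisProgram B F ⟨37, regs x e m a l f k x y 1, T.take m, T.drop m, out'⟩ t)
    (j s y : ℕ) (out : List (List α)) (hx : s + (j + 1) * l = x) (hxe : x ≤ e)
    (hfac : ∀ i ≤ j, (T.drop (s + i * l)).take l = u)
    (hout : Parsed T s out) (hlast : ∀ v ∈ out.getLast?, ¬ SeqLT (omegaSeq v) (omegaSeq u))
    (hB : ∀ r, regs s e m a l f k x y 1 r ≤ B) :
    Runs galoisProgram B F ⟨40, regs s e m a l f k x y 1, T.take m, T.drop m, out⟩
      (t + 6 * ((j + 1) * l)) := by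
  induction j generalizing s y out with
  | zero =>
    rw [Nat.zero_add, Nat.one_mul] at hx ⊢
    refine Runs.mono (t := t + 1 + 1 + 1 + l + 1) ?_ (by omega)
    refine Runs.add rfl hB (by simp; omega) fun hB => ?_
    simp at hB ⊢
    have h0 := hfac 0 le_rfl
    rw [Nat.zero_mul, Nat.add_zero] at h0
    have hem := Runs.emit (t := t + 1 + 1) (P := galoisProgram) (F := F) (pc := 41)
      (rest := T.drop m) (out := out) (a := 0) (b := 8) (seen := T.take m) rfl hB
      (by simp) (by simp; omega)
    simp only [regs_zero, regs_eight, Nat.add_sub_cancel_left] at hem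
    refine hem ?_
    rw [take_drop_take (by omega), h0]
    refine Runs.copy rfl hB fun hB => ?_
    simp at hB ⊢
    refine Runs.jle rfl hB (fun _ => ?_) fun h => ?_
    · rw [hx] at hB ⊢
      refine hfin _ _ ?_ (by simp) hB
      rw [← hx, ← h0]
      refine hout.append (h0 ▸ hu) (h0 ▸ hlast)
    · simp at h; omega
  | succ j ih =>
    have hexp : (j + 1 + 1) * l = (j + 1) * l + l := Nat.succ_mul _ _
    have hpos : 0 < (j + 1) * l := Nat.mul_pos (Nat.succ_pos _) hl
    rw [hexp] at hx ⊢
    refine Runs.mono (t := t + 6 * ((j + 1) * l) + 1 + 1 + 1 + 1 + l + 1) ?_ (by omega)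
    refine Runs.add rfl hB (by simp; omega) fun hB => ?_
    simp at hB ⊢
    have h0 := hfac 0 (Nat.zero_le _)
    rw [Nat.zero_mul, Nat.add_zero] at h0
    have hem := Runs.emit (t := t + 6 * ((j + 1) * l) + 1 + 1 + 1) (P := galoisProgram) (F := F)
      (pc := 41) (rest := T.drop m) (out := out) (a := 0) (b := 8) (seen := T.take m) rfl hB
      (by simp) (by simp; omega)
    simp only [regs_zero, regs_eight, Nat.add_sub_cancel_left] at hem
    refine hem ?_
    rw [take_drop_take (by omega), h0]
    refine Runs.copy rfl hB fun hB => ?_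
    simp at hB ⊢
    refine Runs.jle rfl hB (fun h => ?_) fun _ => ?_
    · simp at h; omega
    · refine Runs.jump rfl hB ?_
      refine ih (s + l) _ _ (by omega) (fun i hi => ?_) ?_ ?_ hB
      · rw [← hfac (i + 1) (by omega)]
        congr 2; ring
      · rw [← h0]
        exact hout.append (h0 ▸ hu) (h0 ▸ hlast)
      · simp only [List.getLast?_concat, Option.mem_def, Option.some.injEq]
        rintro v rfl
        exact SeqLT.irrefl

/-- Whole blocks of even length a leave while they fit, so D keeps its parity c. A block costs 6a
for its factors plus two instructions, within 8a. -/
theorem runs_split_loop {a l f k c : ℕ} (hnm : s + n ≤ m) (hm : m ≤ T.length)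
    (hBT : 5 * T.length + 10 ≤ B) (hl : 0 < l) (ha : 0 < a) (heven : a % 2 = 0) (hla : l ∣ a)
    (han : a ≤ 2 * n) (hper : Per (tailSeq T s) n l) (hu : IsGalois u)
    (hul : (T.drop s).take l = u)
    (hfin : ∀ D out' x y, n < D + a → D ≤ n → l ∣ D → D % 2 = c →
      Parsed T (s + D) out' → (0 < D → out'.getLast? = some u) →
      (∀ r, regs (s + D) (s + n) m a l f k x y 1 r ≤ B) →
      Runs galoisProgram B F
        ⟨1, regs (s + D) (s + n) m a l f k x y 1, T.take m, T.drop m, out'⟩ t)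
    (D x y : ℕ) (out : List (List α)) (hDn : D ≤ n) (hlD : l ∣ D) (hpar : D % 2 = c)
    (hout : Parsed T (s + D) out) (hlast : ∀ v ∈ out.getLast?, ¬ SeqLT (omegaSeq v) (omegaSeq u))
    (hlast' : 0 < D → out.getLast? = some u)
    (hB : ∀ r, regs (s + D) (s + n) m a l f k x y 1 r ≤ B) :
    Runs galoisProgram B F ⟨37, regs (s + D) (s + n) m a l f k x y 1, T.take m, T.drop m, out⟩
      (t + 8 * (n - D) + 3) := by
  induction h : n - D using Nat.strong_induction_on generalizing D x y out with
  | _ μ ih =>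
    refine Runs.add rfl hB (by simp; omega) fun hB => ?_
    simp at hB ⊢
    by_cases hcase : n < D + a
    · refine Runs.mono (t := t + 1 + 1) ?_ (by omega)
      refine Runs.jle rfl hB (fun h => ?_) fun _ => ?_
      · simp at h; omega
      · exact Runs.jump rfl hB (hfin D out _ _ hcase hDn hlD hpar hout hlast' hB)
    · refine Runs.mono (t := t + 8 * (n - (D + a)) + 3 + 6 * a + 1) ?_ (by omega)
      refine Runs.jle rfl hB (fun _ => ?_) fun h => ?_
      · obtain ⟨j, hj⟩ : ∃ j, a = (j + 1) * l := by
          obtain ⟨j, rfl⟩ := hla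
          cases j with
          | zero => simp at ha
          | succ j => exact ⟨j, mul_comm _ _⟩
        have hrun := runs_emit_loop (F := F) (k := k) (f := f) (a := a) (x := s + D + a) (e := s + n)
          (t := t + 8 * (n - (D + a)) + 3) hnm hm hl hu (hB 1) (fun y out' h1 h2 h3 => ?_)
          j (s + D) y out (by omega) (by omega) (fun i hi => ?_) hout hlast hB
        · rwa [← hj] at hrun
        · rw [add_assoc] at h1 h3 ⊢
          refine ih _ ?_ (D + a) _ _ out' (by omega) (hlD.add hla) (by omega) h1 ?_
            (fun _ => h2) h3 rfl
          · omega
          · rw [h2]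
            simp only [Option.mem_def, Option.some.injEq]
            rintro v rfl
            exact SeqLT.irrefl
        · rw [← hul, add_assoc]
          refine take_drop_eq_of_per hper (hlD.add (Dvd.intro_left _ rfl)) ?_
          have : (i + 1) * l ≤ (j + 1) * l := Nat.mul_le_mul_right _ (by omega)
          rw [← hj, Nat.succ_mul] at this
          omega
      · simp at h; omega

/-- The scan has found that the least period `p` of its parity fails at the next letter; `q` is the
least period of the other parity. -/
structure Fails (w : ℕ → WithBot α) (n p q : ℕ) : Prop where
  le : p ≤ n
  leastPer : LeastPer w n p
  leastPer' : LeastPer w n q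
  parity : p % 2 ≠ q % 2
  fails : altRel (n - p) (w n) (w (n - p))

theorem Fails.seqLT_next {w : ℕ → WithBot α} {p q l : ℕ} (h : Fails w n p q)
    (hPG : PG w n) (hcase : FactorLength p q l) {v : List α} (hv : NextLT v w)
    (hul : u.length = l) (hu : ∀ i < n, omegaSeq u i = w i) : SeqLT (omegaSeq u) (omegaSeq v) :=
  hv n p u hPG h.leastPer h.le h.fails hu (omegaSeq_add_of_dvd (hul ▸ hcase.dvd))

/-- The bound n < 3D drives the amortization. For even p, n < D + p with p ≤ 2l and l ≤ D; for odd
p, n < D + 2p and p ≤ D. -/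
theorem runs_split {p q f k x y : ℕ} (hS : ScanInv T s n m out)
    (hBT : 5 * T.length + 10 ≤ B) (hF : Fails (tailSeq T s) n p q) (hf : f = p % 2)
    (hfin : ∀ D out' a b x y, n < 3 * D → D ≤ n → Parsed T (s + D) out' →
      (∀ v ∈ out'.getLast?, NextLT v (tailSeq T (s + D))) →
      (∀ r, regs (s + D) (s + n) m a b f k x y 1 r ≤ B) →
      Runs galoisProgram B F
        ⟨1, regs (s + D) (s + n) m a b f k x y 1, T.take m, T.drop m, out'⟩ t)
    (hB : ∀ r, regs s (s + n) m p q f k x y 1 r ≤ B) :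
    Runs galoisProgram B F ⟨33, regs s (s + n) m p q f k x y 1, T.take m, T.drop m, out⟩
      (t + 8 * n + 10) := by
  have hm := hS.le_length
  have hnm := hS.add_le
  have hPG := hS.pg
  have hp0 := hF.leastPer.1
  have hq0 := hF.leastPer'.1
  have hpn := hF.le
  have hqn := hF.leastPer'.le_add_two
  have hpar := hF.parity
  -- the facts that are common to all cases
  have key : ∀ l, FactorLength p q l → 0 < l ∧ l ≤ n ∧ Per (tailSeq T s) n l ∧
      ((T.drop s).take l).length = l ∧ IsGalois ((T.drop s).take l) ∧
      (∀ v ∈ out.getLast?, ¬ SeqLT (omegaSeq v) (omegaSeq ((T.drop s).take l))) ∧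
      ∀ D, l ∣ D → 0 < D → D ≤ n → D % 2 = p % 2 →
        (n < D + p ∨ p % 2 = 1 ∧ p ≤ D ∧ n < D + 2 * p) →
        NextLT ((T.drop s).take l) (tailSeq T (s + D)) := by
    intro l hl
    have hln : l ≤ n := (Nat.le_of_dvd hp0 hl.dvd).trans hpn
    have hll := hl.leastPer hF.leastPer hF.leastPer'
    have hlen : ((T.drop s).take l).length = l := by simp; omega
    have hul := omegaSeq_take_drop (T := T) (s := s) (l := l) (by omega)
    have hun := omegaSeq_eq_of_per hll.2.1 hll.1 hln hlen hul
    refine ⟨hll.1, hln, hll.2.1, hlen,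
      isGalois_of_factorLength hPG hF.leastPer hF.leastPer' hpar hpn hl hlen hul,
      fun v hv => (hF.seqLT_next hPG hl (hS.next v hv) hlen hun).asymm,
      fun D h1 h2 h3 h4 h5 => ?_⟩
    rw [← tailSeq_shift]
    exact nextLT_of_factorLength hPG hF.leastPer hF.leastPer' hpn hF.fails hl h1 h2 h3 h4 h5 hun
  have hmem : ∀ {out' : List (List α)} {D l : ℕ}, out'.getLast? = some ((T.drop s).take l) →
      NextLT ((T.drop s).take l) (tailSeq T (s + D)) →
      ∀ v ∈ out'.getLast?, NextLT v (tailSeq T (s + D)) := by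
    intro out' D l h1 h2 v hv
    rw [h1] at hv
    simp only [Option.mem_def, Option.some.injEq] at hv
    exact hv ▸ h2
  rcases Nat.mod_two_eq_zero_or_one p with heven | hodd
  · have loop : ∀ l x, FactorLength p q l →
        (∀ r, regs s (s + n) m p l f k x y 1 r ≤ B) →
        Runs galoisProgram B F ⟨37, regs s (s + n) m p l f k x y 1, T.take m, T.drop m, out⟩
          (t + 8 * n + 3) := by
      intro l x hl hB
      obtain ⟨hl0, hln, hper, hlen, hgal, hlast, hnext⟩ := key l hl
      refine runs_split_loop (n := n) (s := s) (c := 0) hnm hm hBT hl0 hp0 heven hl.dvd (by omega)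
        hper hgal rfl (fun D out' x y h1 h2 h3 h4 h5 h6 h7 => ?_) 0 x y out (Nat.zero_le _)
        (dvd_zero l) rfl hS.parsed hlast (fun h => absurd h (lt_irrefl _)) hB
      have hD0 : 0 < D := by omega
      have hlD := Nat.le_of_dvd hD0 h3
      have h2l : p ≤ 2 * l := by
        rcases hl with h | h | h <;> omega
      exact hfin D out' _ _ _ _ (by omega) h2 h5
        (hmem (h6 hD0) (hnext D h3 hD0 h2 (by omega) (.inl h1))) h7
    refine Runs.mono (t := t + 8 * n + 3 + 1 + 1 + 1 + 1) ?_ (by omega)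
    refine Runs.jle rfl hB (fun h => ?_) fun _ => ?_
    · simp at h; omega
    refine Runs.add rfl hB (by simp; omega) fun hB => ?_
    simp at hB ⊢
    refine Runs.jle rfl hB (fun h => ?_) fun h => ?_
    · simp at h
      have h2q := hF.leastPer.le_of_per (hF.leastPer'.2.1.of_dvd (Dvd.intro_left 2 rfl))
        (by omega) (by omega)
      exact (loop q _ (.inr (.inl ⟨by omega, rfl⟩)) hB).mono (by omega)
    · simp at h
      refine Runs.copy rfl hB fun hB => ?_
      simp at hB ⊢
      exact loop p _ (.inl ⟨heven, by omega, rfl⟩) hB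
  · obtain ⟨hl0, hln, hper, hlen, hgal, hlast, hnext⟩ := key p (.inr (.inr ⟨hodd, rfl⟩))
    refine Runs.mono (t := t + 8 * (n - p) + 3 + 6 * ((0 + 1) * p) + 1 + 1 + 1 + 1 + 1) ?_ (by omega)
    refine Runs.jle rfl hB (fun _ => ?_) fun h => ?_
    swap
    · simp at h; omega
    refine Runs.copy rfl hB fun hB => ?_
    simp at hB ⊢
    refine Runs.add rfl hB (by simp; omega) fun hB => ?_
    simp at hB ⊢
    refine Runs.add rfl hB (by simp; omega) fun hB => ?_
    simp at hB ⊢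
    refine Runs.jump rfl hB ?_
    have hrun := runs_emit_loop (F := F) (k := k) (f := f) (a := p + p) (x := s + p) (e := s + n)
      (t := t + 8 * (n - p) + 3) hnm hm hl0 hgal (hB 1) (fun y out' h1 h2 h3 => ?_)
      0 s y out (by omega) (by omega) (fun i hi => ?_) hS.parsed hlast hB
    · simpa using hrun
    · refine runs_split_loop (n := n) (s := s) (c := 1) hnm hm hBT hl0 (by omega) (by omega)
        (Nat.dvd_add dvd_rfl dvd_rfl) (by omega) hper hgal rfl
        (fun D out' x y h4 h5 h6 h7 h8 h9 h10 => ?_) p _ y out' hpn dvd_rfl hodd h1 ?_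
        (fun _ => h2) h3
      · have hD0 : 0 < D := by omega
        have hlD := Nat.le_of_dvd hD0 h6
        exact hfin D out' _ _ _ _ (by omega) h5 h8
          (hmem (h9 hD0) (hnext D h6 hD0 h5 (by omega) (.inr ⟨hodd, hlD, by omega⟩))) h10
      · rw [h2]
        simp only [Option.mem_def, Option.some.injEq]
        rintro v rfl
        exact SeqLT.irrefl
    · obtain rfl : i = 0 := by omega
      simp

/-! ### Scanning one letter, and the amortized bound. -/

/-- The parity of the length flips, so the two periods exchange roles. Register `8` carries the
updated period of the old parity. -/
theorem runs_advance {e a b f k x y : ℕ} (heB : e + 1 ≤ B)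
    (hB : ∀ r, regs s e m a b f k x y 1 r ≤ B)
    (hn : (∀ r, regs s (e + 1) m b y (1 - f) k x y 1 r ≤ B) →
      Runs galoisProgram B F ⟨5, regs s (e + 1) m b y (1 - f) k x y 1, T.take m, T.drop m, out⟩ t) :
    Runs galoisProgram B F ⟨19, regs s e m a b f k x y 1, T.take m, T.drop m, out⟩ (t + 5) := by
  refine Runs.copy rfl hB fun hB => ?_
  simp at hB ⊢
  refine Runs.copy rfl hB fun hB => ?_
  simp at hB ⊢
  refine Runs.sub rfl hB fun hB => ?_
  simp at hB ⊢
  refine Runs.add rfl hB (by simpa using heB) fun hB => ?_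
  simp at hB ⊢
  exact Runs.jump rfl hB (hn hB)

theorem runs_check_other {a a' b f x : ℕ} (hS : ScanInv T s n m out) (hlt : s + n < m)
    (hBT : 5 * T.length + 10 ≤ B) (ha : LeastPer (tailSeq T s) n a)
    (hb : LeastPer (tailSeq T s) n b) (hapar : a % 2 = n % 2) (hbpar : b % 2 = (n + 1) % 2)
    (hf : f = n % 2) (hapar' : a' % 2 = n % 2)
    (hnot : a ≤ n → ¬ altRel (n - a) (tailSeq T s n) (tailSeq T s (n - a)))
    (hnext : ∀ b' f' x, LeastPer (tailSeq T s) (n + 1) b' → b' % 2 = (n + 1) % 2 →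
      f' = (n + 1) % 2 → PG (tailSeq T s) (n + 1) →
      (∀ r, regs s (s + n + 1) m b' a' f' (n + 1) x a' 1 r ≤ B) →
      Runs galoisProgram B F
        ⟨5, regs s (s + n + 1) m b' a' f' (n + 1) x a' 1, T.take m, T.drop m, out⟩ t)
    (hfail : ∀ f' x, Fails (tailSeq T s) n b a → f' = b % 2 →
      (∀ r, regs s (s + n) m b a f' (n + 1) x a' 1 r ≤ B) →
      Runs galoisProgram B F
        ⟨33, regs s (s + n) m b a f' (n + 1) x a' 1, T.take m, T.drop m, out⟩ t)
    (hB : ∀ r, regs s (s + n) m a b f (n + 1) x a' 1 r ≤ B) :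
    Runs galoisProgram B F
      ⟨14, regs s (s + n) m a b f (n + 1) x a' 1, T.take m, T.drop m, out⟩ (t + 10) := by
  have hm := hS.le_length
  have hb0 := hb.1
  have hsucc : ∀ {b' x}, LeastPer (tailSeq T s) (n + 1) b' → b' % 2 = (n + 1) % 2 →
      (b ≤ n → ¬ altRel (n - b) (tailSeq T s n) (tailSeq T s (n - b))) →
      (∀ r, regs s (s + n) m a b' f (n + 1) x a' 1 r ≤ B) →
      Runs galoisProgram B F
        ⟨19, regs s (s + n) m a b' f (n + 1) x a' 1, T.take m, T.drop m, out⟩ (t + 5) :=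
    fun h1 h2 h3 hB => runs_advance (by omega) hB
      (hnext _ _ _ h1 h2 (by omega) (hS.pg.succ ha hb (by omega) hnot h3))
  refine Runs.mono (t := t + 5 + 1 + 1 + 1 + 1) ?_ (by omega)
  refine Runs.jle rfl hB (fun h => ?_) fun h => ?_
  · simp at h
    exact (hsucc (hb.succ_of_per (per_of_le h)) hbpar (fun h' => by omega) hB).mono (by omega)
  simp at h
  have hbn : b ≤ n := by omega
  refine Runs.sub rfl hB fun hB => ?_
  simp at hB ⊢
  rw [Nat.add_sub_assoc hbn] at hB ⊢
  -- At an odd position the order is reversed: a smaller letter starts a new least period, a larger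
  -- one is a failure.
  have hodd : ¬ Even (n - b) := by rw [Nat.even_iff]; omega
  refine Runs.cmp rfl hB (by simpa using hlt) (by simp; omega) hm (fun h => ?_) (fun h => ?_)
    fun h => ?_
  all_goals simp only [regs_one, regs_seven, tailSeq_zero] at h
  · refine Runs.mono (t := t + 5 + 1) ?_ (by omega)
    refine Runs.copy rfl hB fun hB => ?_
    simp at hB ⊢
    have hgt : altRel (n - b) (tailSeq T s (n - b)) (tailSeq T s n) := by
      rwa [altRel, if_neg hodd]
    exact hsucc (hb.succ_of_mismatch hS.pg hbn hgt (Nat.lt_succ_self n) (by omega) hbpar.symm)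
      rfl (fun _ => hgt.asymm) hB
  · refine Runs.mono (t := t + 1 + 1 + 1 + 1) ?_ (by omega)
    refine Runs.copy rfl hB fun hB => ?_
    simp at hB ⊢
    refine Runs.copy rfl hB fun hB => ?_
    simp at hB ⊢
    refine Runs.copy rfl hB fun hB => ?_
    simp at hB ⊢
    refine Runs.sub rfl hB fun hB => ?_
    simp at hB ⊢
    exact hfail _ _ ⟨hbn, hb, ha, by omega, by rwa [altRel, if_neg hodd]⟩ (by omega) hB
  · refine Runs.jump rfl hB ?_
    exact hsucc (hb.succ_of_per (per_succ hb.2.1 h)) hbpar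
      (fun _ h' => by rw [h] at h'; exact altRel_irrefl h') hB

theorem runs_check {a b f x y : ℕ} (hS : ScanInv T s n m out) (hlt : s + n < m)
    (hBT : 5 * T.length + 10 ≤ B) (ha : LeastPer (tailSeq T s) n a)
    (hb : LeastPer (tailSeq T s) n b) (hapar : a % 2 = n % 2) (hbpar : b % 2 = (n + 1) % 2)
    (hf : f = n % 2)
    (hnext : ∀ a' b' f' x y, LeastPer (tailSeq T s) (n + 1) a' →
      LeastPer (tailSeq T s) (n + 1) b' → a' % 2 = (n + 1) % 2 → b' % 2 = n % 2 →
      f' = (n + 1) % 2 → PG (tailSeq T s) (n + 1) →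
      (∀ r, regs s (s + n + 1) m a' b' f' (n + 1) x y 1 r ≤ B) →
      Runs galoisProgram B F
        ⟨5, regs s (s + n + 1) m a' b' f' (n + 1) x y 1, T.take m, T.drop m, out⟩ t)
    (hfail : ∀ p q f' x y, Fails (tailSeq T s) n p q → f' = p % 2 →
      (∀ r, regs s (s + n) m p q f' (n + 1) x y 1 r ≤ B) →
      Runs galoisProgram B F
        ⟨33, regs s (s + n) m p q f' (n + 1) x y 1, T.take m, T.drop m, out⟩ t)
    (hB : ∀ r, regs s (s + n) m a b f (n + 1) x y 1 r ≤ B) :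
    Runs galoisProgram B F
      ⟨8, regs s (s + n) m a b f (n + 1) x y 1, T.take m, T.drop m, out⟩ (t + 15) := by
  have hm := hS.le_length
  have ha0 := ha.1
  have hother : ∀ {a' x}, LeastPer (tailSeq T s) (n + 1) a' → a' % 2 = n % 2 →
      (a ≤ n → ¬ altRel (n - a) (tailSeq T s n) (tailSeq T s (n - a))) →
      (∀ r, regs s (s + n) m a b f (n + 1) x a' 1 r ≤ B) →
      Runs galoisProgram B F
        ⟨14, regs s (s + n) m a b f (n + 1) x a' 1, T.take m, T.drop m, out⟩ (t + 10) :=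
    fun h1 h2 h3 hB => runs_check_other hS hlt hBT ha hb hapar hbpar hf h2 h3
      (fun b' f' x h4 h5 h6 h7 hB => hnext _ _ _ _ _ h4 h1 h5 h2 h6 h7 hB)
      (fun f' x h4 h5 hB => hfail _ _ _ _ _ h4 h5 hB) hB
  refine Runs.mono (t := t + 10 + 1 + 1 + 1 + 1 + 1) ?_ (by omega)
  refine Runs.copy rfl hB fun hB => ?_
  simp at hB ⊢
  refine Runs.jle rfl hB (fun h => ?_) fun h => ?_
  · simp at h
    exact (hother (ha.succ_of_per (per_of_le h)) hapar (fun h' => by omega) hB).mono (by omega)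
  simp at h
  have han : a ≤ n := by omega
  refine Runs.sub rfl hB fun hB => ?_
  simp at hB ⊢
  rw [Nat.add_sub_assoc han] at hB ⊢
  have heven : Even (n - a) := by rw [Nat.even_iff]; omega
  refine Runs.cmp rfl hB (by simpa using hlt) (by simp; omega) hm (fun h => ?_) (fun h => ?_)
    fun h => ?_
  all_goals simp only [regs_one, regs_seven, tailSeq_zero] at h
  · exact (hfail _ _ _ _ _ ⟨han, ha, hb, by omega, by rwa [altRel, if_pos heven]⟩ (by omega)
      hB).mono (by omega)
  · refine Runs.add rfl hB (by simp; omega) fun hB => ?_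
    simp at hB ⊢
    have hgt : altRel (n - a) (tailSeq T s (n - a)) (tailSeq T s n) := by
      rwa [altRel, if_pos heven]
    exact hother (ha.succ_of_mismatch hS.pg han hgt (by omega) le_rfl (by omega))
      (by omega) (fun _ => hgt.asymm) hB
  · refine Runs.jump rfl hB ?_
    exact hother (ha.succ_of_per (per_succ ha.2.1 h)) hapar
      (fun _ h' => by rw [h] at h'; exact altRel_irrefl h') hB

theorem runs_reset {e a b f k x y : ℕ} (hB2 : 2 ≤ B)
    (hB : ∀ r, regs s e m a b f k x y 1 r ≤ B)
    (hn : (∀ r, regs s s m 2 1 0 k x y 1 r ≤ B) →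
      Runs galoisProgram B F ⟨5, regs s s m 2 1 0 k x y 1, T.take m, T.drop m, out⟩ t) :
    Runs galoisProgram B F ⟨1, regs s e m a b f k x y 1, T.take m, T.drop m, out⟩ (t + 4) := by
  refine Runs.copy rfl hB fun hB => ?_
  simp at hB ⊢
  refine Runs.const rfl hB hB2 fun hB => ?_
  simp at hB ⊢
  refine Runs.const rfl hB (by omega) fun hB => ?_
  simp at hB ⊢
  refine Runs.const rfl hB (by omega) fun hB => ?_
  simp at hB ⊢
  exact hn hB

/-- The time bound is 100 times the potential, plus a constant. Accepting a letter raises n by one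
and releases 100 units; splitting off D letters releases 400D - 100n. -/
theorem runs_scan (hBT : 5 * T.length + 10 ≤ B) {a b f k x y : ℕ}
    (hS : ScanInv T s n m out) (ha : LeastPer (tailSeq T s) n a)
    (hb : LeastPer (tailSeq T s) n b) (hapar : a % 2 = n % 2) (hbpar : b % 2 = (n + 1) % 2)
    (hf : f = n % 2) (hB : ∀ r, regs s (s + n) m a b f k x y 1 r ≤ B) :
    Runs galoisProgram B (IsGaloisFactorization T)
      ⟨5, regs s (s + n) m a b f k x y 1, T.take m, T.drop m, out⟩
      (400 * (T.length - s) - 100 * n + 100) := by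
  induction hμ : 4 * (T.length - s) - n using Nat.strong_induction_on
    generalizing s n m a b f k x y out with
  | _ μ ih =>
    have hm := hS.le_length
    have hnm := hS.add_le
    set t := 400 * (T.length - s) - 100 * n + 100 with ht
    -- splitting off factors and continuing with the new remainder
    have hfail : ∀ m, ScanInv T s n m out → ∀ p q f' k x y, Fails (tailSeq T s) n p q →
        f' = p % 2 → (∀ r, regs s (s + n) m p q f' k x y 1 r ≤ B) →
        Runs galoisProgram B (IsGaloisFactorization T)
          ⟨33, regs s (s + n) m p q f' k x y 1, T.take m, T.drop m, out⟩ (t - 40) := by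
      intro m hS p q f' k x y hF hf' hB
      have hm := hS.le_length
      have hnm := hS.add_le
      have hp0 := hF.leastPer.1
      have hpn := hF.le
      refine Runs.mono (t := (t - 40 - (8 * n + 10)) + 8 * n + 10) ?_ (by omega)
      refine runs_split hS hBT hF hf' (fun D out' a b x y h1 h2 h3 h4 hB => ?_) hB
      -- As n < 3D, the released 400D - 100n covers the splitting cost 8n + 10 and the reset.
      refine Runs.mono (t := 400 * (T.length - (s + D)) - 100 * 0 + 100 + 4) ?_ (by omega)
      refine runs_reset (by omega) hB fun hB => ?_
      exact ih (4 * (T.length - (s + D)) - 0) (by omega) (s := s + D) (n := 0)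
        ⟨hm, by omega, h3, h4, fun p b h5 h6 => absurd h6 (Nat.not_lt_zero _)⟩
        -- Periods are positive, so the least even period of the empty remainder is 2.
        (leastPer_zero (by omega) le_rfl) (leastPer_zero (by omega) (by omega)) rfl rfl rfl hB rfl
    have hcheck : ∀ m x y, ScanInv T s n m out → s + n < m →
        (∀ r, regs s (s + n) m a b f (n + 1) x y 1 r ≤ B) →
        Runs galoisProgram B (IsGaloisFactorization T)
          ⟨8, regs s (s + n) m a b f (n + 1) x y 1, T.take m, T.drop m, out⟩ (t - 20) := by
      intro m x y hS hlt hB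
      have hm := hS.le_length
      refine Runs.mono (t := t - 40 + 15) ?_ (by omega)
      refine runs_check hS hlt hBT ha hb hapar hbpar hf
        (fun a' b' f' x y h1 h2 h3 h4 h5 h6 hB => ?_) (fun p q f' x y => hfail m hS p q f' _ x y) hB
      refine Runs.mono (ih (4 * (T.length - s) - (n + 1)) (by omega) (n := n + 1)
        ⟨hm, by omega, hS.parsed, hS.next, h6⟩ h1 h2 h3 (by omega) h5 hB rfl) (by omega)
    refine Runs.mono (t := t - 20 + 1 + 1 + 1 + 1 + 1 + 1) ?_ (by omega)
    refine Runs.add rfl hB (by simp; omega) fun hB => ?_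
    simp at hB ⊢
    refine Runs.sub rfl hB fun hB => ?_
    simp at hB ⊢
    rw [show s + n + 1 - s = n + 1 by omega] at hB ⊢
    refine Runs.jle rfl hB (fun h => ?_) fun h => ?_
    · simp at h
      obtain rfl : m = s + n := by omega
      have hR : ∃ R, T.take (s + n) = out.flatten ++ R ∧ IsPreGalois R :=
        ⟨(T.drop s).take n, by rw [hS.parsed.1, List.take_add], isPreGalois_of_PG hm hS.pg⟩
      refine Runs.read rfl hB hm hR (fun hend => ?_) fun hlt => ?_
      · refine Runs.jle rfl hB (fun h => ?_) fun h => ?_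
        · simp at h
          subst h
          refine Runs.halt rfl hB ?_
          have := hS.parsed
          rw [Parsed, show s = T.length by omega, List.take_length] at this
          exact this
        · simp at h
          refine Runs.mono (t := t - 40 + 1) ?_ (by omega)
          refine Runs.jump rfl hB ?_
          -- n is itself a period, vacuously, and has the parity of a.
          have han : a ≤ n := ha.le_of_per (per_of_le le_rfl) h hapar.symm
          have ha0 := ha.1
          refine hfail _ hS _ _ _ _ _ _ ⟨han, ha, hb, by omega, ?_⟩ (by omega) hB
          -- n - a is even, so the virtual least letter at the end of the text always makes a fail.
          rw [altRel, if_pos (by rw [Nat.even_iff]; omega)]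
          exact tailSeq_bot_lt T s hend (by omega)
      · refine Runs.add rfl hB (by simp; omega) fun hB => ?_
        simp at hB ⊢
        refine Runs.jump rfl hB ?_
        exact hcheck _ _ _ ⟨by omega, by omega, hS.parsed, hS.next, hS.pg⟩ (by omega) hB
    · simp at h
      exact (hcheck m _ _ hS h hB).mono (by omega)

theorem runs_galoisProgram (T : List α) (hBT : 5 * T.length + 10 ≤ B) :
    Runs galoisProgram B (IsGaloisFactorization T) (init 10 T) (400 * T.length + 105) := by
  have hreg : (fun _ => 0 : Fin 10 → ℕ) = regs 0 0 0 0 0 0 0 0 0 0 := by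
    funext i; fin_cases i <;> rfl
  have hinit : (init 10 T) = ⟨0, regs 0 0 0 0 0 0 0 0 0 0, T.take 0, T.drop 0, []⟩ := by
    rw [init, hreg]; rfl
  rw [hinit]
  refine Runs.const rfl (fun i => by rw [← hreg]; exact Nat.zero_le _) (by omega) fun hB => ?_
  simp only [update_regs_nine] at hB ⊢
  refine runs_reset (by omega) hB fun hB => ?_
  have := runs_scan (s := 0) (n := 0) (m := 0) (out := []) hBT
    ⟨Nat.zero_le _, le_rfl, ⟨rfl, by simp, by simp⟩, by simp,
      fun p b h5 h6 => absurd h6 (Nat.not_lt_zero _)⟩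
    (leastPer_zero (by omega) le_rfl) (leastPer_zero (by omega) (by omega)) rfl rfl rfl hB
  exact this.mono (by omega)

end OnlineRAM

open GaloisWord OnlineRAM in
theorem mainTheorem3 :
    ∃ (k : ℕ) (P : Program k) (C : ℕ),
      ∀ (α : Type*) [LinearOrder α] (T : List α),
        -- `T` has exactly one Galois factorization `G`
        ∃ G : List (List α),
          IsGaloisFactorization T G ∧
          (∀ G' : List (List α), IsGaloisFactorization T G' → G' = G) ∧
          -- on `T`, the program stops after `O(|T|)` time and has then output `G`
          (∃ (t : ℕ) (c : Config α k), Reaches P (init k T) t c ∧ Halted P c ∧ c.out = G ∧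
            t ≤ C * (T.length + 1)) ∧
          -- at all times the `k` registers hold numbers in `O(|T|)`
          (∀ (t : ℕ) (c : Config α k), Reaches P (init k T) t c →
            ∀ r : Fin k, c.reg r ≤ C * (T.length + 1)) ∧
          -- online: when the program requests the next letter, what it has read so far is already
          -- output as factors, except for a remainder `R` which is pre-Galois
          (∀ (t : ℕ) (c : Config α k), Reaches P (init k T) t c → Requests P c →
            ∃ R : List α, c.seen = c.out.flatten ++ R ∧ IsPreGalois R) := by
  refine ⟨10, galoisProgram, 400, fun α _ T => ?_⟩
  have hrun := runs_galoisProgram (B := 400 * (T.length + 1)) T (by omega)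
  obtain ⟨t, c, h1, h2, h3, h4⟩ := hrun.reaches_halted
  refine ⟨c.out, h3, fun G' hG' => h3.unique hG', ⟨t, c, h1, h2, rfl, by omega⟩,
    fun t c hc => ?_, fun t c hc => ?_⟩
  · obtain ⟨s, hs⟩ := hrun.of_reaches hc
    exact hs.sound.1
  · obtain ⟨s, hs⟩ := hrun.of_reaches hc
    exact hs.sound.2
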